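/- Let $\mathcal H$ be the Butcher–Connes–Kreimer Hopf algebra over $\mathbb R$: the free commutative algebra on the (non-empty, finite, non-planar) rooted trees, with coproduct $\Delta(\tau)=\sum_c P_c(\tau)\otimes R_c(\tau)$ over the admissible cuts $c$ of $\tau$ (the empty and the total cut included, $P_c(\tau)$ being the pruned forest and $R_c(\tau)$ the remaining tree at the root), and antipode $S$. Let $|\tau|$ be the number of vertices of $\tau$ and $\bar S(\tau)=(-1)^{|\tau|}S(\tau)$. Let $\mathrm{Id}^{1/2}$ be the unique multiplicative linear map $\mathcal H\to\mathcal H$ whose convolution square is the identity map. With $\mu$ the multiplication of $\mathcal H$, put $$\tau^-=\mu\circ(\bar S\otimes\mathrm{Id})\circ\Delta\circ\mathrm{Id}^{1/2}(\tau),\qquad \tau^+=\mu\circ\bigl(\mathrm{Id}\otimes((\cdot)^-\circ S)\bigr)\circ\Delta(\tau).$$ The antisymmetric order of a character (unital algebra homomorphism) $\psi:\mathcal H\to\mathbb R$ is $$\mathrm{ord}^+(\psi)=\sup\{n\in\mathbb N:\ \psi(\tau^+)=0\text{ for all trees }\tau\text{ with }|\tau|\le n\}\in\mathbb N\cup\{\infty\}.$$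 Let $f:\mathbb R^N\to\mathbb R^N$ be a smooth vector field. The B-series method with character $\psi$ is the formal power series in $h$ $$B_h(\psi,y)=y+\sum_{\tau}\frac{h^{|\tau|}}{\sigma(\tau)}\,\psi(\tau)\,F(\tau)(y),$$ where the sum is over all rooted trees, $\sigma(\tau)$ is the symmetry factor of $\tau$ and $F(\tau)$ is the elementary differential, $F([\tau_1,\dots,\tau_k])(y)=f^{(k)}(y)\bigl(F(\tau_1)(y),\dots,F(\tau_k)(y)\bigr)$. Its modified differential equation is the formal equation $\dot{\tilde y}=f_1(\tilde y)+hf_2(\tilde y)+h^2f_3(\tilde y)+\cdots$ with smooth fields $f_j:\mathbb R^N\to\mathbb R^N$ whose formal exact solution at time $h$ with initial value $y$ equals $B_h(\psi,y)$, as a formal power series in $h$, for every $y\in\mathbb R^N$. **Theorem.** Let $\psi$ be a character of antisymmetric order $m\in\mathbb N\cup\{\infty\}$. Then the modified differential equation exists and is unique, $f_1=\psi(\bullet)f$ (so $f_1=f$ if the method is consistent, i.e. $\psi(\bullet)=1$), and $f_j=0$ for every even $j$ with $1\le j\le m$. Consequently the modified equation has an expansion in even powers of $h$ up to terms of order $h^m$: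 for every $M\in\mathbb N$ with $M\le m$, every $h\in\mathbb R$ and every $y\in\mathbb R^N$, $$\sum_{k=0}^{M-1}h^kf_{k+1}(y)=\sum_{0\le 2l<M}h^{2l}f_{2l+1}(y).$$ -/

import Mathlib

open scoped ContDiff TensorProduct

noncomputable section

/-! ### Rooted trees -/

/-- Finite multisets form a quotient of a polynomial functor: a multiset of cardinality `n` is
represented by a function on `Fin n`. -/
instance multisetQPF : QPF Multiset.{0} where
  P := ⟨ℕ, Fin⟩
  abs := fun p => (List.ofFn p.2 : Multiset _)
  repr := fun s => ⟨s.toList.length, s.toList.get⟩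
  abs_repr := fun s => by
    change ((List.ofFn s.toList.get : List _) : Multiset _) = s
    rw [List.ofFn_get, Multiset.coe_toList]
  abs_map := fun g p => by
    obtain ⟨n, u⟩ := p
    change ((List.ofFn (g ∘ u) : List _) : Multiset _) = Multiset.map g (List.ofFn u : List _)
    rw [Multiset.map_coe, List.map_ofFn]

/-- (Non-empty, finite, unlabelled, non-planar) rooted trees: the initial algebra of the functor
`Multiset`, so that a rooted tree is the same thing as a finite multiset of rooted trees, the
branches at its root. -/
def RTree : Type := QPF.Fix Multiset.{0}

namespace RTree

/-- `node {τ₁, …, τₖ} = [τ₁, …, τₖ]`, the tree whose root has the branches `τ₁, …, τₖ`. -/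
def node (s : Multiset RTree) : RTree := QPF.Fix.mk s

/-- The multiset of branches at the root. -/
def branches (τ : RTree) : Multiset RTree := QPF.Fix.dest τ

theorem node_branches (τ : RTree) : node τ.branches = τ := QPF.Fix.mk_dest τ

theorem branches_node (s : Multiset RTree) : (node s).branches = s := QPF.Fix.dest_mk s

theorem node_injective : Function.Injective node := fun s t h => by
  rw [← branches_node s, h, branches_node]

/-- Structural induction on rooted trees. -/
theorem induction {p : RTree → Prop} (h : ∀ s, (∀ t ∈ s, p t) → p (node s)) (τ : RTree) :
    p τ := by
  refine QPF.Fix.ind p (fun s hs => h s ?_) τ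
  obtain ⟨u, rfl⟩ := hs
  intro t ht
  obtain ⟨v, -, rfl⟩ := Multiset.mem_map.1 ht
  exact v.2

/-- Structural recursion on rooted trees: the value at `[τ₁, …, τₖ]` is computed from the multiset
of the branches, each of them paired with its value. -/
def fold {α : Type} (g : Multiset (RTree × α) → α) (τ : RTree) : α :=
  (QPF.Fix.rec (fun s : Multiset (RTree × α) => (node (s.map Prod.fst), g s)) τ).2

theorem fold_node {α : Type} (g : Multiset (RTree × α) → α) (s : Multiset RTree) :
    fold g (node s) = g (s.map fun t => (t, fold g t)) := by
  set G : Multiset (RTree × α) → RTree × α := fun s => (node (s.map Prod.fst), g s)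
  have key : ∀ s : Multiset RTree,
      QPF.Fix.rec G (node s) = G (s.map (QPF.Fix.rec G)) := fun s => QPF.Fix.rec_eq G s
  have hfst : ∀ τ : RTree, (QPF.Fix.rec G τ).1 = τ := by
    intro τ
    induction τ using RTree.induction with
    | h s ih =>
      rw [key]
      have h1 : (s.map fun t : RTree => QPF.Fix.rec G t).map Prod.fst = s := by
        rw [Multiset.map_map]
        conv_rhs => rw [← Multiset.map_id s]
        exact Multiset.map_congr rfl ih
      exact congrArg node h1
  change (QPF.Fix.rec G (node s)).2 = _
  rw [key]
  change g _ = g _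
  congr 1
  refine Multiset.map_congr rfl fun t _ => ?_
  exact Prod.ext (hfst t) rfl

/-- The tree with one vertex. -/
def single : RTree := node 0

/-- The order `|τ|`, i.e. the number of vertices. -/
def order : RTree → ℕ := fold fun s => 1 + (s.map Prod.snd).sum

theorem order_node (s : Multiset RTree) : (node s).order = 1 + (s.map order).sum := by
  rw [order, fold_node, Multiset.map_map]; rfl

open Classical in
/-- The symmetry factor `σ(τ)`:
`σ([τ₁^{k₁}, …, τₘ^{kₘ}]) = ∏ᵢ kᵢ! σ(τᵢ)^{kᵢ}` for distinct `τ₁, …, τₘ`. -/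
def symmetryFactor : RTree → ℕ :=
  fold fun s => (s.map Prod.snd).prod *
    ∏ t ∈ (s.map Prod.fst).toFinset, ((s.map Prod.fst).count t).factorial

open Classical in
theorem symmetryFactor_node (s : Multiset RTree) :
    (node s).symmetryFactor =
      ∏ t ∈ s.toFinset, (s.count t).factorial * t.symmetryFactor ^ s.count t := by
  have h : (s.map fun t => (t, fold (fun s : Multiset (RTree × ℕ) => (s.map Prod.snd).prod *
      ∏ t ∈ (s.map Prod.fst).toFinset, ((s.map Prod.fst).count t).factorial) t)).map Prod.fst = s := by
    rw [Multiset.map_map]; exact Multiset.map_id s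
  rw [symmetryFactor, fold_node, h, Multiset.map_map, Finset.prod_mul_distrib, mul_comm,
    Finset.prod_multiset_map_count]
  rfl

theorem finite_order_le (n : ℕ) : {τ : RTree | τ.order ≤ n}.Finite := by
  induction n with
  | zero =>
    refine Set.Finite.subset Set.finite_empty fun τ hτ => ?_
    rw [Set.mem_ofPred_eq, ← node_branches τ, order_node] at hτ
    omega
  | succ n ih =>
    have hfin : {s : Multiset RTree |
        (∀ t ∈ s, t ∈ {τ : RTree | τ.order ≤ n}) ∧ Multiset.card s ≤ n}.Finite := by
      refine Set.Finite.subset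
        ((@List.finite_length_le {τ : RTree | τ.order ≤ n} ih.to_subtype n).image
          fun l => ((l.map Subtype.val : List RTree) : Multiset RTree)) ?_
      rintro s ⟨hs, hc⟩
      refine ⟨s.toList.attach.map fun t => ⟨t.1, hs t.1 (Multiset.mem_toList.1 t.2)⟩, ?_, ?_⟩
      · simpa using hc
      · simp
    refine (hfin.image node).subset fun τ hτ => ⟨τ.branches, ⟨?_, ?_⟩, node_branches τ⟩
    · intro t ht
      rw [Set.mem_ofPred_eq, ← node_branches τ, order_node] at hτ
      have := Multiset.single_le_sum (fun x _ => Nat.zero_le x) _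
        (Multiset.mem_map_of_mem order ht)
      rw [Set.mem_ofPred_eq]
      omega
    · rw [Set.mem_ofPred_eq, ← node_branches τ, order_node] at hτ
      have h1 : ∀ x ∈ τ.branches.map order, 1 ≤ x := by
        intro x hx
        obtain ⟨t, -, rfl⟩ := Multiset.mem_map.1 hx
        rw [← node_branches t, order_node]; omega
      have := Multiset.card_nsmul_le_sum h1
      simp only [Multiset.card_map, smul_eq_mul, mul_one] at this
      omega

/-- The finite set of all rooted trees with `n` vertices. -/
def ofOrder (n : ℕ) : Finset RTree :=
  (show {τ : RTree | τ.order = n}.Finite from (finite_order_le n).subset fun _ h => by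
    rw [Set.mem_ofPred_eq] at h ⊢; exact h.le).toFinset

theorem mem_ofOrder {n : ℕ} {τ : RTree} : τ ∈ ofOrder n ↔ τ.order = n := by
  simp [ofOrder]

/-- The elementary differential `F(τ)` of a vector field `f`:
`F([τ₁, …, τₖ])(y) = f⁽ᵏ⁾(y)(F(τ₁)(y), …, F(τₖ)(y))`. The branches are listed in some order, which
does not matter for smooth `f`, since the derivative is symmetric. -/
def elementaryDifferential {E : Type} [NormedAddCommGroup E] [NormedSpace ℝ E] (f : E → E) :
    RTree → E → E :=
  fold fun s y => iteratedFDeriv ℝ s.toList.length f y fun i => (s.toList.get i).2 y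

theorem iteratedFDeriv_perm {E : Type} [NormedAddCommGroup E] [NormedSpace ℝ E]
    {f : E → E} (hf : ContDiff ℝ ∞ f) {l₁ l₂ : List E} (h : l₁.Perm l₂) (y : E) :
    iteratedFDeriv ℝ l₁.length f y l₁.get = iteratedFDeriv ℝ l₂.length f y l₂.get := by
  have hd : ∀ l : List E, ContDiff ℝ ∞ fun z => iteratedFDeriv ℝ l.length f z l.get := by
    intro l
    have h1 : ContDiff ℝ ∞ fun z => iteratedFDeriv ℝ l.length f z :=
      hf.iteratedFDeriv_right (by exact_mod_cast le_top)
    exact (ContinuousMultilinearMap.apply ℝ (fun _ : Fin l.length => E) E l.get).contDiff.comp h1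
  have hc : ∀ (v : E) (l : List E) (z : E), iteratedFDeriv ℝ (v :: l).length f z (v :: l).get =
      fderiv ℝ (fun w => iteratedFDeriv ℝ l.length f w l.get) z v := by
    intro v l z
    have h1 : DifferentiableAt ℝ (fun w => iteratedFDeriv ℝ l.length f w) z :=
      (hf.iteratedFDeriv_right (m := ∞) (by exact_mod_cast le_top)).differentiable (by simp) z
    have h2 : fderiv ℝ (fun w => iteratedFDeriv ℝ l.length f w l.get) z =
        (ContinuousMultilinearMap.apply ℝ (fun _ : Fin l.length => E) E l.get).comp
          (fderiv ℝ (fun w => iteratedFDeriv ℝ l.length f w) z) :=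
      ((ContinuousMultilinearMap.apply ℝ (fun _ : Fin l.length => E) E l.get).hasFDerivAt.comp z
        h1.hasFDerivAt).fderiv
    rw [h2]
    rfl
  induction h generalizing y with
  | nil => rfl
  | cons v _ ih => rw [hc, hc, funext ih]
  | swap a b l =>
    have hs : IsSymmSndFDerivAt ℝ (fun z => iteratedFDeriv ℝ l.length f z l.get) y :=
      (hd l).contDiffAt.isSymmSndFDerivAt (by
        rw [minSmoothness_of_isRCLikeNormedField]; exact WithTop.coe_le_coe.2 le_top)
    have h3 : ∀ u v : E, fderiv ℝ (fun z =>
        fderiv ℝ (fun w => iteratedFDeriv ℝ l.length f w l.get) z v) y u =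
        fderiv ℝ (fderiv ℝ fun w => iteratedFDeriv ℝ l.length f w l.get) y u v := by
      intro u v
      have h4 : DifferentiableAt ℝ (fderiv ℝ fun w => iteratedFDeriv ℝ l.length f w l.get) y :=
        ((hd l).fderiv_right (m := ∞) (by simp)).differentiable (by simp) y
      have h5 : fderiv ℝ (fun z =>
          fderiv ℝ (fun w => iteratedFDeriv ℝ l.length f w l.get) z v) y = _ :=
        ((ContinuousLinearMap.apply ℝ E v).hasFDerivAt.comp y h4.hasFDerivAt).fderiv
      rw [h5]
      rfl
    rw [hc, hc, funext (hc a l), funext (hc b l), h3, h3]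
    exact hs b a
  | trans _ _ ih₁ ih₂ => rw [ih₁, ih₂]

theorem elementaryDifferential_node {E : Type} [NormedAddCommGroup E] [NormedSpace ℝ E]
    {f : E → E} (hf : ContDiff ℝ ∞ f) (l : List RTree) (y : E) :
    elementaryDifferential f (node (l : Multiset RTree)) y =
      iteratedFDeriv ℝ l.length f y fun i => elementaryDifferential f (l.get i) y := by
  have key : ∀ (α : Type) (l : List α) (g : α → E),
      (iteratedFDeriv ℝ l.length f y fun i => g (l.get i)) =
        iteratedFDeriv ℝ (l.map g).length f y (l.map g).get := by
    intro α l g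
    have : ∀ (n : ℕ) (hn : n = l.length) (v : Fin n → E) (_ : ∀ i, v i = g (l.get (i.cast hn))),
        (iteratedFDeriv ℝ l.length f y fun i => g (l.get i)) = iteratedFDeriv ℝ n f y v := by
      rintro _ rfl v hv
      rw [funext hv]
      rfl
    exact this _ (by simp) _ (by simp)
  rw [show elementaryDifferential f (node (l : Multiset RTree)) = _ from fold_node _ _]
  change (iteratedFDeriv ℝ _ f y fun i => (fun p : RTree × (E → E) => p.2 y) (List.get _ i)) = _
  rw [key _ _ fun p : RTree × (E → E) => p.2 y, key _ l fun t => elementaryDifferential f t y]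
  refine iteratedFDeriv_perm hf ?_ y
  rw [← Multiset.coe_eq_coe, ← Multiset.map_coe, ← Multiset.map_coe, Multiset.coe_toList,
    Multiset.map_map]
  rfl

/-! ### Cuts -/

/-- The non-total admissible cuts `c` of a tree `τ` (the empty cut included), each recorded as the
pair `(P_c(τ), R_c(τ))` of the pruned forest and of the remaining tree at the root. A non-total
admissible cut of `[τ₁, …, τₖ]` amounts to a choice, for every `i`, either to cut the edge from the
root to `τᵢ`, and no edge in `τᵢ`, or to keep that edge and to choose a non-total admissible cut
of `τᵢ`. -/
def admissibleCuts : RTree → Multiset (Multiset RTree × RTree) :=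
  fold fun s =>
    (Multiset.Sections (s.map fun t =>
      (({t.1}, 0) : Multiset RTree × Multiset RTree) ::ₘ
        t.2.map fun c => (c.1, {c.2}))).map
      fun l => (l.sum.1, node l.sum.2)

theorem admissibleCuts_node (s : Multiset RTree) :
    (node s).admissibleCuts =
      (Multiset.Sections (s.map fun t =>
        (({t}, 0) : Multiset RTree × Multiset RTree) ::ₘ
          t.admissibleCuts.map fun c => (c.1, {c.2}))).map
        fun l => (l.sum.1, node l.sum.2) := by
  rw [admissibleCuts, fold_node, Multiset.map_map]; rfl

theorem order_pos (τ : RTree) : 0 < τ.order := by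
  rw [← node_branches τ, order_node]; omega

theorem order_of_mem_admissibleCuts (τ : RTree) :
    ∀ c ∈ τ.admissibleCuts, (c.1.map order).sum + c.2.order = τ.order := by
  have aux : ∀ s : Multiset RTree,
      (∀ t ∈ s, ∀ c ∈ t.admissibleCuts, (c.1.map order).sum + c.2.order = t.order) →
      ∀ l ∈ Multiset.Sections (s.map fun t =>
        (({t}, 0) : Multiset RTree × Multiset RTree) ::ₘ
          t.admissibleCuts.map fun c => (c.1, {c.2})),
        (l.sum.1.map order).sum + (l.sum.2.map order).sum = (s.map order).sum := by
    intro s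
    induction s using Multiset.induction with
    | empty =>
      intro _ l hl
      rw [Multiset.map_zero, Multiset.sections_zero, Multiset.mem_singleton] at hl
      simp [hl]
    | cons t s ih =>
      intro h l hl
      rw [Multiset.map_cons, Multiset.sections_cons, Multiset.mem_bind] at hl
      obtain ⟨a, ha, hl⟩ := hl
      obtain ⟨l, hl', rfl⟩ := Multiset.mem_map.1 hl
      have h1 := ih (fun t ht => h t (Multiset.mem_cons_of_mem ht)) l hl'
      have h2 : (a.1.map order).sum + (a.2.map order).sum = t.order := by
        rcases Multiset.mem_cons.1 ha with rfl | ha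
        · simp
        · obtain ⟨c, hc, rfl⟩ := Multiset.mem_map.1 ha
          simpa using h t (Multiset.mem_cons_self t s) c hc
      rw [Multiset.sum_cons, Prod.fst_add, Prod.snd_add, Multiset.map_add, Multiset.map_add,
        Multiset.sum_add, Multiset.sum_add, Multiset.map_cons, Multiset.sum_cons]
      omega
  induction τ using RTree.induction with
  | h s ih =>
    intro c hc
    rw [admissibleCuts_node] at hc
    obtain ⟨l, hl, rfl⟩ := Multiset.mem_map.1 hc
    have := aux s ih l hl
    simp only [order_node]
    omega

/-- The empty cut occurs exactly once among the non-total admissible cuts. -/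
theorem admissibleCuts_eq_cons (τ : RTree) : ∃ M : Multiset (Multiset RTree × RTree),
    τ.admissibleCuts = (0, τ) ::ₘ M ∧ ∀ c ∈ M, c.1 ≠ 0 := by
  have aux : ∀ s : Multiset RTree,
      (∀ t ∈ s, ∃ M : Multiset (Multiset RTree × RTree),
        t.admissibleCuts = (0, t) ::ₘ M ∧ ∀ c ∈ M, c.1 ≠ 0) →
      ∃ M : Multiset (Multiset (Multiset RTree × Multiset RTree)),
        Multiset.Sections (s.map fun t =>
          (({t}, 0) : Multiset RTree × Multiset RTree) ::ₘ
            t.admissibleCuts.map fun c => (c.1, {c.2})) = (s.map fun t => (0, {t})) ::ₘ M ∧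
        ∀ l ∈ M, l.sum.1 ≠ 0 := by
    intro s
    induction s using Multiset.induction with
    | empty => exact fun _ => ⟨0, by simp, by simp⟩
    | cons t s ih =>
      intro h
      obtain ⟨M, hM, hM0⟩ := ih fun t ht => h t (Multiset.mem_cons_of_mem ht)
      obtain ⟨B, hB, hB0⟩ := h t (Multiset.mem_cons_self t s)
      have h1 : (({t}, 0) : Multiset RTree × Multiset RTree) ::ₘ
          t.admissibleCuts.map (fun c => (c.1, {c.2})) =
          (0, {t}) ::ₘ ({t}, 0) ::ₘ B.map fun c => (c.1, {c.2}) := by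
        rw [hB, Multiset.map_cons, Multiset.cons_swap]
      have h2 : ∀ a ∈ (({t}, 0) : Multiset RTree × Multiset RTree) ::ₘ
          B.map fun c => (c.1, {c.2}), a.1 ≠ 0 := by
        intro a ha
        rcases Multiset.mem_cons.1 ha with rfl | ha
        · simp
        · obtain ⟨c, hc, rfl⟩ := Multiset.mem_map.1 ha
          exact hB0 c hc
      rw [Multiset.map_cons, Multiset.sections_cons, h1, Multiset.cons_bind, hM, Multiset.map_cons,
        Multiset.map_cons, Multiset.cons_add]
      refine ⟨_, rfl, fun l hl => ?_⟩
      rcases Multiset.mem_add.1 hl with hl | hl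
      · obtain ⟨l, hl', rfl⟩ := Multiset.mem_map.1 hl
        simpa using hM0 l hl'
      · obtain ⟨a, ha, hl⟩ := Multiset.mem_bind.1 hl
        obtain ⟨l, -, rfl⟩ := Multiset.mem_map.1 hl
        rw [Multiset.sum_cons, Prod.fst_add]
        exact fun h0 => h2 a ha (add_eq_zero.1 h0).1
  induction τ using RTree.induction with
  | h s ih =>
    obtain ⟨M, hM, hM0⟩ := aux s ih
    refine ⟨M.map fun l => (l.sum.1, node l.sum.2), ?_, ?_⟩
    · rw [admissibleCuts_node, hM, Multiset.map_cons]
      have h1 : ∀ s : Multiset RTree,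
          (s.map fun t => ((0, {t}) : Multiset RTree × Multiset RTree)).sum = (0, s) := by
        intro s
        induction s using Multiset.induction with
        | empty => rfl
        | cons t s ih => rw [Multiset.map_cons, Multiset.sum_cons, ih]; simp
      rw [h1]
    · intro c hc
      obtain ⟨l, hl, rfl⟩ := Multiset.mem_map.1 hc
      exact hM0 l hl

/-- All the cuts (sets of edges) `c` of a tree `τ`, each recorded as the pair formed by the forest
of those components of `τ^c` that do not contain the root of `τ`, and by the component that does.
The number `|c|` of edges cut is the number of trees in the first entry. A cut of `[τ₁, …, τₖ]`
amounts to a choice, for every `i`, of a cut of `τᵢ` and of whether to keep or to cut the edge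
from the root to `τᵢ`. -/
def allCuts : RTree → Multiset (Multiset RTree × RTree) :=
  fold fun s =>
    (Multiset.Sections (s.map fun t =>
      (t.2.map fun c => ((c.1, {c.2}) : Multiset RTree × Multiset RTree)) +
        t.2.map fun c => (c.2 ::ₘ c.1, 0))).map
      fun l => (l.sum.1, node l.sum.2)

theorem allCuts_node (s : Multiset RTree) :
    (node s).allCuts =
      (Multiset.Sections (s.map fun t =>
        (t.allCuts.map fun c => ((c.1, {c.2}) : Multiset RTree × Multiset RTree)) +
          t.allCuts.map fun c => (c.2 ::ₘ c.1, 0))).map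
        fun l => (l.sum.1, node l.sum.2) := by
  rw [allCuts, fold_node, Multiset.map_map]; rfl

end RTree

/-! ### The Butcher–Connes–Kreimer Hopf algebra -/

/-- The free commutative `ℝ`-algebra on the rooted trees; its monomials are the forests, and `1`
is the empty forest (or empty tree). -/
abbrev BCK : Type := MvPolynomial RTree ℝ

namespace BCK

open MvPolynomial

/-- The product of the trees in a forest. -/
def forest (s : Multiset RTree) : BCK := (s.map fun t => (X t : BCK)).prod

/-- The coproduct, `Δ(τ) = τ ⊗ ∅ + ∑_c P_c(τ) ⊗ R_c(τ)`, extended multiplicatively; the sum is over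
the non-total admissible cuts, and the first summand is the contribution of the total cut. -/
def comul : BCK →ₐ[ℝ] BCK ⊗[ℝ] BCK :=
  aeval fun τ => (X τ : BCK) ⊗ₜ[ℝ] (1 : BCK) +
    (τ.admissibleCuts.map fun c => forest c.1 ⊗ₜ[ℝ] (X c.2 : BCK)).sum

/-- The reduced coproduct `δ(τ) = Δ(τ) - τ ⊗ ∅ - ∅ ⊗ τ` of a tree. -/
def reducedComul (τ : RTree) : BCK ⊗[ℝ] BCK :=
  comul (X τ) - (X τ : BCK) ⊗ₜ[ℝ] (1 : BCK) - (1 : BCK) ⊗ₜ[ℝ] (X τ : BCK)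

/-- The antipode, `S(τ) = ∑_c (-1)^{|c| + 1} τ^c`, summed over all cuts of the tree `τ` and extended
multiplicatively. -/
def antipode : BCK →ₐ[ℝ] BCK :=
  aeval fun τ =>
    (τ.allCuts.map fun c => (-1 : BCK) ^ (Multiset.card c.1 + 1) * (forest c.1 * X c.2)).sum

/-- The convolution product `μ ∘ (φ ⊗ χ) ∘ Δ` of two linear maps. -/
def conv (φ χ : BCK →ₗ[ℝ] BCK) : BCK →ₗ[ℝ] BCK :=
  LinearMap.mul' ℝ BCK ∘ₗ TensorProduct.map φ χ ∘ₗ comul.toLinearMap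

/-- Iterates for the recursion that determines the convolution square root of the identity; the
`n`-th one has the correct values on the trees of order at most `n`. -/
def sqrtIdAux : ℕ → (BCK →ₐ[ℝ] BCK)
  | 0 => aeval fun _ => 0
  | n + 1 => aeval fun τ => (1 / 2 : ℝ) • ((X τ : BCK) -
      LinearMap.mul' ℝ BCK (TensorProduct.map (sqrtIdAux n).toLinearMap (sqrtIdAux n).toLinearMap
        (reducedComul τ)))

/-- `Id^{1/2}`, the unique multiplicative map whose convolution square is the identity (see
`conv_sqrtId_sqrtId`). It is given on trees by the recursion
`Id^{1/2}(τ) = (τ - μ ((Id^{1/2} ⊗ Id^{1/2}) (δ(τ)))) / 2`. -/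
def sqrtId : BCK →ₐ[ℝ] BCK := aeval fun τ => sqrtIdAux τ.order (X τ)

theorem reducedComul_eq (τ : RTree) : ∃ M : Multiset (Multiset RTree × RTree),
    reducedComul τ = (M.map fun c => forest c.1 ⊗ₜ[ℝ] (X c.2 : BCK)).sum ∧
      ∀ c ∈ M, (∀ t ∈ c.1, t.order < τ.order) ∧ c.2.order < τ.order := by
  obtain ⟨M, hM, hM0⟩ := τ.admissibleCuts_eq_cons
  refine ⟨M, ?_, fun c hc => ?_⟩
  · rw [reducedComul, comul, aeval_X, hM, Multiset.map_cons, Multiset.sum_cons]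
    simp [forest]
  · have h1 := τ.order_of_mem_admissibleCuts c (by rw [hM]; exact Multiset.mem_cons_of_mem hc)
    have h2 := c.2.order_pos
    have h3 : ∀ t ∈ c.1, t.order ≤ (c.1.map RTree.order).sum := fun t ht =>
      Multiset.single_le_sum (fun x _ => Nat.zero_le x) _ (Multiset.mem_map_of_mem RTree.order ht)
    refine ⟨fun t ht => ?_, ?_⟩
    · have := h3 t ht
      omega
    · obtain ⟨t, ht⟩ := Multiset.exists_mem_of_ne_zero (hM0 c hc)
      have := h3 t ht
      have := t.order_pos
      omega

theorem map_reducedComul_congr {φ₁ φ₂ : BCK →ₐ[ℝ] BCK} {τ : RTree}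
    (h : ∀ t : RTree, t.order < τ.order → φ₁ (X t) = φ₂ (X t)) :
    TensorProduct.map φ₁.toLinearMap φ₁.toLinearMap (reducedComul τ) =
      TensorProduct.map φ₂.toLinearMap φ₂.toLinearMap (reducedComul τ) := by
  obtain ⟨M, hM, hlt⟩ := reducedComul_eq τ
  rw [hM, map_multiset_sum, map_multiset_sum, Multiset.map_map, Multiset.map_map]
  congr 1
  refine Multiset.map_congr rfl fun c hc => ?_
  have h1 : φ₁ (forest c.1) = φ₂ (forest c.1) := by
    rw [forest, map_multiset_prod, map_multiset_prod, Multiset.map_map, Multiset.map_map]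
    congr 1
    exact Multiset.map_congr rfl fun t ht => h t ((hlt c hc).1 t ht)
  simp [h1, h c.2 (hlt c hc).2]

theorem sqrtIdAux_eq (n : ℕ) : ∀ (k : ℕ) (τ : RTree), n ≤ k → τ.order ≤ n →
    sqrtIdAux k (X τ) = sqrtIdAux n (X τ) := by
  induction n with
  | zero => intro k τ _ hτ; have := τ.order_pos; omega
  | succ n ih =>
    intro k τ hk hτ
    obtain ⟨k, rfl⟩ : ∃ j, k = j + 1 := ⟨k - 1, by omega⟩
    rw [sqrtIdAux, sqrtIdAux, aeval_X, aeval_X,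
      map_reducedComul_congr fun t ht => ih k t (by omega) (by omega)]

theorem sqrtId_X (τ : RTree) : sqrtId (X τ) = (1 / 2 : ℝ) • ((X τ : BCK) -
    LinearMap.mul' ℝ BCK (TensorProduct.map sqrtId.toLinearMap sqrtId.toLinearMap
      (reducedComul τ))) := by
  obtain ⟨n, hn⟩ : ∃ n, τ.order = n + 1 := ⟨τ.order - 1, by have := τ.order_pos; omega⟩
  have h : ∀ t : RTree, t.order < τ.order → sqrtId (X t) = sqrtIdAux n (X t) := by
    intro t ht
    rw [sqrtId, aeval_X]
    exact (sqrtIdAux_eq _ n t (by omega) le_rfl).symm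
  rw [map_reducedComul_congr h, sqrtId, aeval_X, hn, sqrtIdAux, aeval_X]

theorem conv_sqrtId_sqrtId : conv sqrtId.toLinearMap sqrtId.toLinearMap = LinearMap.id := by
  have h : ((Algebra.TensorProduct.lmul' ℝ (S := BCK)).comp
      ((Algebra.TensorProduct.map sqrtId sqrtId).comp comul)) = AlgHom.id ℝ BCK := by
    refine MvPolynomial.algHom_ext fun τ => ?_
    change LinearMap.mul' ℝ BCK (TensorProduct.map sqrtId.toLinearMap sqrtId.toLinearMap
      (comul (X τ))) = X τ
    have h1 : comul (X τ) = reducedComul τ + (X τ : BCK) ⊗ₜ[ℝ] (1 : BCK) +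
        (1 : BCK) ⊗ₜ[ℝ] (X τ : BCK) := by
      rw [reducedComul]; abel
    have h2 := sqrtId_X τ
    rw [h1]
    simp only [map_add, TensorProduct.map_tmul, LinearMap.mul'_apply, AlgHom.toLinearMap_apply,
      map_one, mul_one, one_mul]
    rw [add_assoc, ← two_smul ℝ (sqrtId (X τ)), h2, smul_smul]
    norm_num
  exact congrArg AlgHom.toLinearMap h

/-- The canonical involution, `τ ↦ (-1)^{|τ|} τ`. -/
def involution : BCK →ₐ[ℝ] BCK := aeval fun τ => (-1 : ℝ) ^ τ.order • (X τ : BCK)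

/-- The map `τ ↦ τ⁻ = (μ ∘ (S̄ ⊗ Id) ∘ Δ ∘ Id^{1/2})(τ)`, where `S̄(τ) = (-1)^{|τ|} S(τ)`. -/
def minus : BCK →ₗ[ℝ] BCK :=
  conv (antipode.comp involution).toLinearMap LinearMap.id ∘ₗ sqrtId.toLinearMap

/-- The map `τ ↦ τ⁺ = (μ ∘ (Id ⊗ (·)⁻ ∘ S) ∘ Δ)(τ)`. -/
def plus : BCK →ₗ[ℝ] BCK := conv LinearMap.id (minus ∘ₗ antipode.toLinearMap)

end BCK

/-! ### B-series methods and their antisymmetric order -/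

/-- The characters of the Hopf algebra, i.e. the elements of the Butcher group; every one of them
defines a B-series method. -/
abbrev ButcherCharacter : Type := BCK →ₐ[ℝ] ℝ

namespace ButcherCharacter

open MvPolynomial

/-- The antisymmetric order `sup {n ∈ ℕ : ψ(τ⁺) = 0 for all trees τ with |τ| ≤ n}`; it is `⊤` for a
symmetric method. -/
def antisymmetricOrder (ψ : ButcherCharacter) : ℕ∞ :=
  ⨆ (n : ℕ) (_ : ∀ τ : RTree, τ.order ≤ n → ψ (BCK.plus (X τ)) = 0), (n : ℕ∞)

variable {E : Type} [NormedAddCommGroup E] [NormedSpace ℝ E]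

/-- The coefficient of `h ^ n` in the B-series
`B_h(ψ, y) = y + ∑_τ h^{|τ|} / σ(τ) ψ(τ) F(τ)(y)` of the vector field `f`. -/
def bSeriesCoeff (ψ : ButcherCharacter) (f : E → E) (n : ℕ) (y : E) : E :=
  if n = 0 then y
  else ∑ τ ∈ RTree.ofOrder n,
    (ψ (X τ) / τ.symmetryFactor : ℝ) • τ.elementaryDifferential f y

end ButcherCharacter

/-! ### The modified differential equation -/

namespace FormalField

variable {E : Type} [NormedAddCommGroup E] [NormedSpace ℝ E]

/-- The Lie derivative `y ↦ G_h'(y) (v_h(y))` of the formal power series `G_h = ∑ h^n G_n` in `h`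
along the formal vector field `v_h = ∑ h^n c_n`. -/
def lieDeriv (c G : ℕ → E → E) : ℕ → E → E := fun n y =>
  ∑ p ∈ Finset.HasAntidiagonal.antidiagonal n, fderiv ℝ (G p.2) y (c p.1 y)

/-- The identity map, as a formal power series in `h`. -/
def idSeries : ℕ → E → E := fun n y => if n = 0 then y else 0

/-- The coefficient of `h ^ n` in the formal exact solution at time `t = h`, with initial value `y`,
of the differential equation with right-hand side `v_h = ∑ h^k c_k`. If `D` denotes the Lie
derivative along `v_h`, then a solution `u` satisfies `u⁽ⁱ⁾(t) = (Dⁱ id)(u(t))`, so that its Taylor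
series is `∑ tⁱ / i! (Dⁱ id)(y)`, in which `t = h` is substituted. -/
def flowCoeff (c : ℕ → E → E) (n : ℕ) (y : E) : E :=
  ∑ i ∈ Finset.range (n + 1), (1 / (i.factorial : ℝ)) • ((lieDeriv c)^[i] idSeries) (n - i) y

end FormalField

/-- `u' = c₀(u) + h c₁(u) + h² c₂(u) + ⋯` is the modified differential equation of the B-series
method with character `ψ`, applied to the vector field `f`: the coefficients are smooth, and one
step of the method agrees, as a formal power series in `h` and for every initial value, with the
exact solution of this equation at time `h`. In the usual numbering `c_k = f_{k+1}`. -/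
structure IsModifiedEquation {E : Type} [NormedAddCommGroup E] [NormedSpace ℝ E]
    (ψ : ButcherCharacter) (f : E → E) (c : ℕ → E → E) : Prop where
  smooth : ∀ k, ContDiff ℝ ∞ (c k)
  flow_eq : ∀ (n : ℕ) (y : E), FormalField.flowCoeff c n y = ψ.bSeriesCoeff f n y

end

noncomputable section

/-! ### Multisets of choices -/

/-! Write `*` for the convolution of characters, `ε` for the counit and `ψ̄(τ) = (-1)^{|τ|} ψ(τ)`.
Two facts give the theorem.

Algebra. The character `ψ⁻` is the convolution square root of `(ψ ∘ S̄) * ψ`, and `ψ(τ⁺) = (ψ * (ψ⁻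
∘ S))(τ)`. If this vanishes on all trees up to order `n`, right cancellation gives `ψ = ψ⁻` there;
squaring, `ψ * ψ = (ψ ∘ S̄) * ψ`, so `ψ = ψ ∘ S̄` and hence `ψ * ψ̄ = ε` up to order `n`
(`mul_bar_X_eq_zero`). Now write `ψ = exp(a)` up to order `n`, with `a` infinitesimal. Then `ψ̄ =
exp(ā)`, while the inverse of `exp(a)` is `exp(-a)`. Thus `ā = -a`, that is, `a` vanishes on trees
of even order (`eq_zero_of_even_order`).

Analysis. The field `∑ h^{|τ|-1} a(τ)/σ(τ) F(τ)` has the B-series of `exp(a)` as its time-`h` flow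
(`flowCoeff_elementarySum`). Indeed the Lie derivative of `F(τ₂)` along `F(τ₁)` is the sum of the
`F` of all graftings of `τ₁` onto `τ₂` (`fderiv_elementaryDifferential`). Weighted by symmetry
factors, grafting is dual to cutting one edge (`symmetryFactor_mul_count_graft`), and weighted edge
cutting is the contraction of the coproduct with `a` (`contract_infinitesimal`). Iterated Lie
derivatives therefore correspond to convolution powers of `a`.

The coefficient of `h^{n+1}` in a flow is `c_n` plus terms in `c_0, …, c_{n-1}`, so a formal field
is determined by its flow, existence follows by recursion, and agreement of flows up to a given
order suffices for comparing coefficients. Hence `f_j` is a sum of `a(τ)/σ(τ) F(τ)` over `|τ| = j`,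
which is zero for even `j ≤ m`. -/

theorem Multiset.sum_map_sections_prod {R ι α : Type*} [CommSemiring R] (s : Multiset ι)
    (m : ι → Multiset α) (w : α → R) :
    ((Multiset.Sections (s.map m)).map fun l => (l.map w).prod).sum =
      (s.map fun t => ((m t).map w).sum).prod := by
  induction s using Multiset.induction with
  | empty => simp
  | cons t s ih =>
    rw [Multiset.map_cons, Multiset.sections_cons, Multiset.map_bind, Multiset.sum_bind,
      Multiset.map_cons, Multiset.prod_cons, ← ih, ← Multiset.sum_map_mul_right]
    congr 1
    refine Multiset.map_congr rfl fun a _ => ?_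
    rw [Multiset.map_map, ← Multiset.sum_map_mul_left]
    simp

/-- The form used for cuts: choices are made independently at each branch and then added up, so a
multiplicative weight factors over the branches. -/
theorem Multiset.sum_map_sections_sum {R ι α : Type*} [CommSemiring R] [AddCommMonoid α]
    (s : Multiset ι) (m : ι → Multiset α) (w : α → R) (h0 : w 0 = 1)
    (hadd : ∀ a b, w (a + b) = w a * w b) :
    ((Multiset.Sections (s.map m)).map fun l => w l.sum).sum =
      (s.map fun t => ((m t).map w).sum).prod := by
  rw [← Multiset.sum_map_sections_prod]
  congr 1
  refine Multiset.map_congr rfl fun l hl => ?_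
  clear hl
  induction l using Multiset.induction with
  | empty => simpa using h0
  | cons a l ih => simp [hadd, ih]

namespace BCK

open MvPolynomial

/-! ### Forests and the grafting operator `B₊` -/

@[simp] theorem forest_zero : forest 0 = 1 := by simp [forest]

@[simp] theorem forest_cons (t : RTree) (s : Multiset RTree) :
    forest (t ::ₘ s) = X t * forest s := by simp [forest]

theorem forest_singleton (t : RTree) : forest {t} = X t := by simp [forest]

theorem forest_add (s t : Multiset RTree) : forest (s + t) = forest s * forest t := by
  simp [forest]

open Classical in
theorem forest_eq_monomial (s : Multiset RTree) :
    forest s = monomial (Multiset.toFinsupp s) (1 : ℝ) := by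
  induction s using Multiset.induction with
  | empty => simp
  | cons t s ih =>
    rw [forest_cons, ih, ← Multiset.singleton_add, Multiset.toFinsupp_add,
      Multiset.toFinsupp_singleton, X, monomial_mul, one_mul]

theorem map_forest {A : Type*} [CommSemiring A] [Algebra ℝ A] (φ : BCK →ₐ[ℝ] A)
    (s : Multiset RTree) : φ (forest s) = (s.map fun t => φ (X t)).prod := by
  rw [forest, map_multiset_prod, Multiset.map_map]; rfl

theorem map_forest_congr {A : Type*} [CommSemiring A] [Algebra ℝ A] {φ χ : BCK →ₐ[ℝ] A}
    {s : Multiset RTree} (h : ∀ t ∈ s, φ (X t) = χ (X t)) : φ (forest s) = χ (forest s) := by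
  rw [map_forest, map_forest]
  exact congrArg _ (Multiset.map_congr rfl h)

open Classical in
theorem linearMap_ext_forest {M : Type*} [AddCommMonoid M] [Module ℝ M] {φ χ : BCK →ₗ[ℝ] M}
    (h : ∀ s, φ (forest s) = χ (forest s)) : φ = χ := by
  refine (basisMonomials RTree ℝ).ext fun m => ?_
  have := h (Finsupp.toMultiset m)
  rw [forest_eq_monomial, Finsupp.toMultiset_toFinsupp] at this
  simpa using this

/-- Tree induction for algebra maps: agreement on all branches is agreement on the forest they form,
so only the passage from a forest to its `B₊` needs checking. -/
theorem algHom_ext_node {A : Type*} [CommSemiring A] [Algebra ℝ A] {φ χ : BCK →ₐ[ℝ] A}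
    (h : ∀ s, φ (forest s) = χ (forest s) → φ (X (RTree.node s)) = χ (X (RTree.node s))) :
    φ = χ := by
  refine algHom_ext fun τ => ?_
  induction τ using RTree.induction with
  | h s ih => exact h s (map_forest_congr ih)

/-- The operator `B₊`, that joins the trees of a forest to a common root. -/
def bplus : BCK →ₗ[ℝ] BCK :=
  (basisMonomials RTree ℝ).constr ℝ fun m => X (RTree.node (Finsupp.toMultiset m))

open Classical in
@[simp] theorem bplus_forest (s : Multiset RTree) : bplus (forest s) = X (RTree.node s) := by
  have := (basisMonomials RTree ℝ).constr_basis ℝ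
    (fun m => (X (RTree.node (Finsupp.toMultiset m)) : BCK)) (Multiset.toFinsupp s)
  rw [coe_basisMonomials] at this
  rw [forest_eq_monomial, bplus, this, Multiset.toFinsupp_toMultiset]

/-! ### The coproduct -/

theorem comul_X (τ : RTree) : comul (X τ) = (X τ : BCK) ⊗ₜ[ℝ] (1 : BCK) +
    (τ.admissibleCuts.map fun c => forest c.1 ⊗ₜ[ℝ] (X c.2 : BCK)).sum := by
  rw [comul, aeval_X]

theorem comul_forest (s : Multiset RTree) :
    comul (forest s) = ((Multiset.Sections (s.map fun t =>
        (({t}, 0) : Multiset RTree × Multiset RTree) ::ₘ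
          t.admissibleCuts.map fun c => (c.1, {c.2}))).map
        fun l => forest l.sum.1 ⊗ₜ[ℝ] forest l.sum.2).sum := by
  rw [Multiset.sum_map_sections_sum s _
    (fun p : Multiset RTree × Multiset RTree => forest p.1 ⊗ₜ[ℝ] forest p.2), map_forest]
  · congr 1
    refine Multiset.map_congr rfl fun t _ => ?_
    rw [comul_X, Multiset.map_cons, Multiset.sum_cons, Multiset.map_map]
    simp [forest_singleton]
  · simp [Algebra.TensorProduct.one_def]
  · intro a b
    simp [forest_add]

/-- The cocycle property of `B₊`. Cutting the edge from the root to a branch acts as the total cut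
of that branch, so the non-total cuts of `B₊(s)` are exactly the terms of `Δ(s)`; the total cut is
the extra summand. -/
theorem comul_bplus (x : BCK) :
    comul (bplus x) = bplus x ⊗ₜ[ℝ] (1 : BCK) + bplus.lTensor BCK (comul x) := by
  have h : comul.toLinearMap ∘ₗ bplus = (TensorProduct.mk ℝ BCK BCK).flip 1 ∘ₗ bplus +
      bplus.lTensor BCK ∘ₗ comul.toLinearMap := by
    refine linearMap_ext_forest fun s => ?_
    simp only [LinearMap.comp_apply, LinearMap.add_apply, AlgHom.toLinearMap_apply, bplus_forest,
      LinearMap.flip_apply, TensorProduct.mk_apply]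
    rw [comul_X, comul_forest, RTree.admissibleCuts_node, map_multiset_sum, Multiset.map_map,
      Multiset.map_map]
    congr 2
    exact Multiset.map_congr rfl fun l _ => by simp
  exact LinearMap.congr_fun h x

/-- Both sides are algebra maps, and the cocycle property reduces their values on `B₊(s)` to those
on `s`. -/
theorem coassoc (x : BCK) :
    TensorProduct.assoc ℝ BCK BCK BCK (comul.toLinearMap.rTensor BCK (comul x)) =
      comul.toLinearMap.lTensor BCK (comul x) := by
  have h : ((Algebra.TensorProduct.assoc ℝ ℝ ℝ BCK BCK BCK).toAlgHom.comp
      (Algebra.TensorProduct.map comul (AlgHom.id ℝ BCK))).comp comul =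
      (Algebra.TensorProduct.map (AlgHom.id ℝ BCK) comul).comp comul := by
    refine algHom_ext_node (A := BCK ⊗[ℝ] (BCK ⊗[ℝ] BCK)) fun s ih => ?_
    change TensorProduct.assoc ℝ BCK BCK BCK (comul.toLinearMap.rTensor BCK (comul _)) =
      comul.toLinearMap.lTensor BCK (comul _) at ih ⊢
    rw [← bplus_forest, comul_bplus]
    have h1 : ∀ z : BCK ⊗[ℝ] BCK,
        comul.toLinearMap.lTensor BCK (bplus.lTensor BCK z) =
          TensorProduct.assoc ℝ BCK BCK BCK (bplus.lTensor BCK z ⊗ₜ[ℝ] (1 : BCK)) +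
          (bplus.lTensor BCK).lTensor BCK (comul.toLinearMap.lTensor BCK z) := by
      intro z
      induction z with
      | zero => simp
      | add z w hz hw => simp only [map_add, TensorProduct.add_tmul, hz, hw]; abel
      | tmul p q => simp [comul_bplus, TensorProduct.tmul_add]
    have h2 : ∀ z : BCK ⊗[ℝ] BCK,
        TensorProduct.assoc ℝ BCK BCK BCK
          (comul.toLinearMap.rTensor BCK (bplus.lTensor BCK z)) =
          (bplus.lTensor BCK).lTensor BCK
            (TensorProduct.assoc ℝ BCK BCK BCK (comul.toLinearMap.rTensor BCK z)) := by
      intro z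
      induction z with
      | zero => simp
      | add z w hz hw => simp only [map_add, hz, hw]
      | tmul p q =>
        simp only [LinearMap.lTensor_tmul, LinearMap.rTensor_tmul, AlgHom.toLinearMap_apply]
        induction comul p with
        | zero => simp
        | add z w hz hw => simp only [map_add, TensorProduct.add_tmul, hz, hw]
        | tmul p q => simp
    rw [map_add, map_add, map_add, h1, h2, ih, LinearMap.rTensor_tmul, AlgHom.toLinearMap_apply,
      comul_bplus, TensorProduct.add_tmul, map_add, LinearMap.lTensor_tmul,
      TensorProduct.assoc_tmul, AlgHom.toLinearMap_apply, map_one, Algebra.TensorProduct.one_def,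
      add_assoc]
  exact AlgHom.congr_fun h x

/-! ### The antipode -/

/-- The signed sum over all cuts of a tree, the component of the root being kept apart. -/
def signedCuts (τ : RTree) : BCK ⊗[ℝ] BCK :=
  (τ.allCuts.map fun c => ((-1) ^ Multiset.card c.1 * forest c.1) ⊗ₜ[ℝ] (X c.2 : BCK)).sum

theorem antipode_X (τ : RTree) :
    antipode (X τ) = -LinearMap.mul' ℝ BCK (signedCuts τ) := by
  rw [antipode, aeval_X, signedCuts, map_multiset_sum, ← Multiset.sum_map_neg, Multiset.map_map]
  congr 1
  refine Multiset.map_congr rfl fun c _ => ?_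
  simp [pow_succ, mul_assoc]

/-- The multiplicative extension of the signed sum over the cuts of a planted tree. -/
def plantedCuts : BCK →ₐ[ℝ] BCK ⊗[ℝ] BCK :=
  aeval fun τ => antipode (X τ) ⊗ₜ[ℝ] (1 : BCK) + signedCuts τ

/-- A cut of `B₊(s)` is a cut of each planted branch: either the root edge is cut, with one more
sign, which produces `S(t) ⊗ 1`, or it is kept, which produces `signedCuts t`. -/
theorem signedCuts_node (s : Multiset RTree) :
    signedCuts (RTree.node s) = bplus.lTensor BCK (plantedCuts (forest s)) := by
  have h : plantedCuts (forest s) = ((Multiset.Sections (s.map fun t =>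
        (t.allCuts.map fun c => ((c.1, {c.2}) : Multiset RTree × Multiset RTree)) +
          t.allCuts.map fun c => (c.2 ::ₘ c.1, 0))).map
        fun l => ((-1) ^ Multiset.card l.sum.1 * forest l.sum.1) ⊗ₜ[ℝ] forest l.sum.2).sum := by
    rw [Multiset.sum_map_sections_sum s _ (fun p : Multiset RTree × Multiset RTree =>
      ((-1) ^ Multiset.card p.1 * forest p.1) ⊗ₜ[ℝ] forest p.2), map_forest]
    · congr 1
      refine Multiset.map_congr rfl fun t _ => ?_
      rw [plantedCuts, aeval_X, Multiset.map_add, Multiset.sum_add, Multiset.map_map,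
        Multiset.map_map, add_comm]
      congr 1
      · simp [signedCuts, forest_singleton]
      · have h1 : antipode (X t) ⊗ₜ[ℝ] (1 : BCK) =
          (TensorProduct.mk ℝ BCK BCK).flip 1 (antipode (X t)) := rfl
        rw [h1, antipode, aeval_X, map_multiset_sum, Multiset.map_map]
        congr 1
        refine Multiset.map_congr rfl fun c _ => ?_
        simp [mul_comm (X c.2 : BCK)]
    · simp [Algebra.TensorProduct.one_def]
    · intro a b
      simp only [Prod.fst_add, Prod.snd_add, Multiset.card_add, forest_add, pow_add,
        Algebra.TensorProduct.tmul_mul_tmul]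
      congr 1
      ring
  rw [h, signedCuts, RTree.allCuts_node, map_multiset_sum, Multiset.map_map, Multiset.map_map]
  congr 1
  exact Multiset.map_congr rfl fun l _ => by simp

theorem antipode_bplus (x : BCK) :
    antipode (bplus x) = -LinearMap.mul' ℝ BCK (bplus.lTensor BCK (plantedCuts x)) := by
  have h : antipode.toLinearMap ∘ₗ bplus =
      -(LinearMap.mul' ℝ BCK ∘ₗ bplus.lTensor BCK ∘ₗ plantedCuts.toLinearMap) := by
    refine linearMap_ext_forest fun s => ?_
    simp [antipode_X, signedCuts_node]
  exact LinearMap.congr_fun h x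

theorem plantedCuts_bplus (x : BCK) : plantedCuts (bplus x) =
    antipode (bplus x) ⊗ₜ[ℝ] (1 : BCK) + bplus.lTensor BCK (plantedCuts x) := by
  have h : plantedCuts.toLinearMap ∘ₗ bplus =
      (TensorProduct.mk ℝ BCK BCK).flip 1 ∘ₗ antipode.toLinearMap ∘ₗ bplus +
        bplus.lTensor BCK ∘ₗ plantedCuts.toLinearMap := by
    refine linearMap_ext_forest fun s => ?_
    simp only [LinearMap.comp_apply, LinearMap.add_apply, AlgHom.toLinearMap_apply, bplus_forest,
      ← signedCuts_node]
    simp [plantedCuts]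
  exact LinearMap.congr_fun h x

/-- The identity followed by the planted cuts of the second factor, multiplied into the first. -/
def idPlantedCuts : BCK →ₐ[ℝ] BCK ⊗[ℝ] BCK :=
  (Algebra.TensorProduct.lift Algebra.TensorProduct.includeLeft plantedCuts
    fun _ _ => Commute.all _ _).comp comul

theorem idPlantedCuts_bplus (x : BCK) : idPlantedCuts (bplus x) =
    conv LinearMap.id antipode.toLinearMap (bplus x) ⊗ₜ[ℝ] (1 : BCK) +
      bplus.lTensor BCK (idPlantedCuts x) := by
  simp only [idPlantedCuts, conv, AlgHom.comp_apply, LinearMap.comp_apply,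
    AlgHom.toLinearMap_apply, comul_bplus, map_add, TensorProduct.add_tmul]
  rw [add_assoc]
  congr 1
  · simp
  · induction comul x with
    | zero => simp
    | add z w hz hw =>
      simp only [map_add, TensorProduct.add_tmul, hz, hw]; abel
    | tmul p q =>
      simp only [LinearMap.lTensor_tmul, Algebra.TensorProduct.lift_tmul, plantedCuts_bplus,
        mul_add]
      congr 1
      · simp
      · induction plantedCuts q with
        | zero => simp
        | add z w hz hw => simp only [map_add, mul_add, hz, hw]
        | tmul u v => simp

/-- Together with `idPlantedCuts_bplus` this expresses both `Id * S` and `idPlantedCuts` at `B₊(x)`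
through `idPlantedCuts x`, so one induction settles both. -/
theorem conv_id_antipode_bplus (x : BCK) :
    conv LinearMap.id antipode.toLinearMap (bplus x) =
      bplus x - LinearMap.mul' ℝ BCK (bplus.lTensor BCK (idPlantedCuts x)) := by
  simp only [idPlantedCuts, conv, AlgHom.comp_apply, LinearMap.comp_apply,
    AlgHom.toLinearMap_apply, comul_bplus, map_add]
  rw [sub_eq_add_neg]
  congr 1
  · simp
  · induction comul x with
    | zero => simp
    | add z w hz hw => simp only [map_add, hz, hw, neg_add]
    | tmul p q =>
      simp only [LinearMap.lTensor_tmul, Algebra.TensorProduct.lift_tmul, TensorProduct.map_tmul,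
        AlgHom.toLinearMap_apply, antipode_bplus, LinearMap.mul'_apply, LinearMap.id_apply, mul_neg]
      congr 1
      induction plantedCuts q with
      | zero => simp
      | add z w hz hw => simp only [map_add, mul_add, hz, hw]
      | tmul u v => simp [mul_assoc]

/-- If the value at `x` is `1 ⊗ x`, then `(Id * S)(B₊ x) = B₊ x - B₊ x = 0`, and the recursion
leaves `1 ⊗ B₊ x`. -/
theorem idPlantedCuts_eq : idPlantedCuts = Algebra.TensorProduct.includeRight := by
  refine algHom_ext_node fun s ih => ?_
  rw [← bplus_forest, idPlantedCuts_bplus, conv_id_antipode_bplus, ih]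
  simp

/-- The antipode is a right convolution inverse of the identity. -/
theorem conv_id_antipode_X (τ : RTree) : conv LinearMap.id antipode.toLinearMap (X τ) = 0 := by
  rw [← RTree.node_branches τ, ← bplus_forest, conv_id_antipode_bplus, idPlantedCuts_eq]
  simp

end BCK

namespace ButcherCharacter

open MvPolynomial BCK

/-! ### The convolution product of characters -/

/-- The convolution product of two characters. -/
def mul (φ χ : ButcherCharacter) : ButcherCharacter :=
  (Algebra.TensorProduct.lift φ χ fun _ _ => Commute.all _ _).comp comul

/-- The counit. -/
def counit : ButcherCharacter := aeval fun _ => 0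

@[simp] theorem counit_X (τ : RTree) : counit (X τ) = 0 := by simp [counit]

theorem comp_conv_apply (ψ : ButcherCharacter) (α β : BCK →ₐ[ℝ] BCK) (x : BCK) :
    ψ (conv α.toLinearMap β.toLinearMap x) = mul (ψ.comp α) (ψ.comp β) x := by
  simp only [conv, mul, LinearMap.comp_apply, AlgHom.comp_apply, AlgHom.toLinearMap_apply]
  induction comul x with
  | zero => simp
  | add z w hz hw => simp only [map_add, hz, hw]
  | tmul p q => simp

theorem mul_X (φ χ : ButcherCharacter) (τ : RTree) :
    mul φ χ (X τ) = φ (X τ) + χ (X τ) +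
      Algebra.TensorProduct.lift φ χ (fun _ _ => Commute.all _ _) (reducedComul τ) := by
  simp [mul, reducedComul]

/-- Triangularity of the convolution: the reduced coproduct of `τ` involves only smaller trees, so
the values at `τ` itself enter additively. Cancellation and the comparison of logarithms rest on
this. -/
theorem mul_X_sub_mul_X {φ φ' χ χ' : ButcherCharacter} {τ : RTree}
    (hφ : ∀ t : RTree, t.order < τ.order → φ (X t) = φ' (X t))
    (hχ : ∀ t : RTree, t.order < τ.order → χ (X t) = χ' (X t)) :
    mul φ χ (X τ) - mul φ' χ' (X τ) =
      (φ (X τ) - φ' (X τ)) + (χ (X τ) - χ' (X τ)) := by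
  have h : Algebra.TensorProduct.lift φ χ (fun _ _ => Commute.all _ _) (reducedComul τ) =
      Algebra.TensorProduct.lift φ' χ' (fun _ _ => Commute.all _ _) (reducedComul τ) := by
    obtain ⟨M, hM, hlt⟩ := reducedComul_eq τ
    rw [hM, map_multiset_sum, map_multiset_sum, Multiset.map_map, Multiset.map_map]
    congr 1
    refine Multiset.map_congr rfl fun c hc => ?_
    simp only [Function.comp_apply, Algebra.TensorProduct.lift_tmul]
    rw [map_forest_congr fun t ht => hφ t ((hlt c hc).1 t ht), hχ _ (hlt c hc).2]
  rw [mul_X, mul_X, h]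
  ring

theorem mul_X_congr {φ φ' χ χ' : ButcherCharacter} {τ : RTree}
    (hφ : ∀ t : RTree, t.order ≤ τ.order → φ (X t) = φ' (X t))
    (hχ : ∀ t : RTree, t.order ≤ τ.order → χ (X t) = χ' (X t)) :
    mul φ χ (X τ) = mul φ' χ' (X τ) := by
  have := mul_X_sub_mul_X (fun t ht => hφ t ht.le) fun t ht => hχ t ht.le
  rw [hφ τ le_rfl, hχ τ le_rfl] at this
  linarith

/-- Right cancellation, up to a given order. -/
theorem eq_of_mul_right_eq {φ φ' χ : ButcherCharacter} {n : ℕ}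
    (h : ∀ τ : RTree, τ.order ≤ n → mul φ χ (X τ) = mul φ' χ (X τ)) :
    ∀ τ : RTree, τ.order ≤ n → φ (X τ) = φ' (X τ) := by
  suffices H : ∀ k ≤ n, ∀ τ : RTree, τ.order = k → φ (X τ) = φ' (X τ) from
    fun τ hτ => H _ hτ τ rfl
  intro k
  induction k using Nat.strong_induction_on with
  | _ k ih =>
    rintro hk τ rfl
    have := mul_X_sub_mul_X (τ := τ) (χ := χ) (χ' := χ)
      (fun t ht => ih _ ht (ht.le.trans hk) t rfl) fun t _ => rfl
    rw [h τ hk] at this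
    linarith

theorem mul_antipode_X (φ : ButcherCharacter) (τ : RTree) :
    mul φ (φ.comp antipode) (X τ) = 0 := by
  have := comp_conv_apply φ (AlgHom.id ℝ BCK) antipode (X τ)
  rw [AlgHom.comp_id] at this
  rw [← this]
  erw [conv_id_antipode_X]
  simp

/-- The conjugate of a character under the canonical involution. -/
def bar (φ : ButcherCharacter) : ButcherCharacter := φ.comp involution

theorem bar_X (φ : ButcherCharacter) (τ : RTree) :
    φ.bar (X τ) = (-1) ^ τ.order * φ (X τ) := by
  simp [bar, involution]

/-! ### Symmetry up to the antisymmetric order -/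

/-- The character `ψ⁻ : τ ↦ ψ(τ⁻)`. -/
def minusPart (ψ : ButcherCharacter) : ButcherCharacter :=
  (mul (ψ.comp (antipode.comp involution)) ψ).comp sqrtId

theorem comp_minus (ψ : ButcherCharacter) (x : BCK) : ψ (minus x) = ψ.minusPart x := by
  have := comp_conv_apply ψ (antipode.comp involution) (AlgHom.id ℝ BCK) (sqrtId x)
  rw [AlgHom.comp_id] at this
  exact this

/-- Composition with a character turns the identity `Id^{1/2} * Id^{1/2} = Id` into a square root in
the group of characters. -/
theorem minusPart_mul_minusPart (ψ : ButcherCharacter) :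
    mul ψ.minusPart ψ.minusPart = mul (ψ.comp (antipode.comp involution)) ψ := by
  refine AlgHom.ext fun x => ?_
  have := comp_conv_apply (mul (ψ.comp (antipode.comp involution)) ψ) sqrtId sqrtId x
  rw [conv_sqrtId_sqrtId] at this
  exact this.symm

theorem comp_plus (ψ : ButcherCharacter) (x : BCK) :
    ψ (plus x) = mul ψ (ψ.minusPart.comp antipode) x := by
  simp only [plus, conv, mul, LinearMap.comp_apply, AlgHom.comp_apply, AlgHom.toLinearMap_apply]
  induction comul x with
  | zero => simp
  | add z w hz hw => simp only [map_add, hz, hw]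
  | tmul p q => simp [comp_minus]

theorem mul_bar_X_eq_zero {ψ : ButcherCharacter} {n : ℕ}
    (h : ∀ τ : RTree, τ.order ≤ n → ψ (plus (X τ)) = 0) {τ : RTree} (hτ : τ.order ≤ n) :
    mul ψ ψ.bar (X τ) = 0 := by
  -- Both `ψ` and `ψ⁻` are annihilated by right convolution with `ψ⁻ ∘ S`, up to order `n`.
  have h1 : ∀ τ : RTree, τ.order ≤ n → ψ (X τ) = ψ.minusPart (X τ) :=
    eq_of_mul_right_eq (χ := ψ.minusPart.comp antipode) fun τ hτ => by
      rw [← comp_plus, h τ hτ, mul_antipode_X]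
  have h2 : ∀ τ : RTree, τ.order ≤ n →
      ψ (X τ) = (ψ.comp (antipode.comp involution)) (X τ) := by
    refine eq_of_mul_right_eq (χ := ψ) fun τ hτ => ?_
    rw [← minusPart_mul_minusPart]
    exact mul_X_congr (fun t ht => h1 t (ht.trans hτ)) fun t ht => h1 t (ht.trans hτ)
  -- Since `ψ = ψ ∘ S̄` up to order `n`, the two signs cancel in `ψ̄` and it agrees with the inverse
  -- `ψ ∘ S`.
  rw [← mul_antipode_X ψ τ]
  refine mul_X_congr (fun _ _ => rfl) fun t ht => ?_
  rw [bar_X, h2 t (ht.trans hτ)]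
  simp [involution, ← mul_assoc, ← mul_pow]

/-- The defining condition is inherited by smaller `n`, so a tree on which it fails bounds the
supremum by `|τ| - 1`; this is below `|τ|` because trees are non-empty. -/
theorem plus_eq_zero_of_le_antisymmetricOrder {ψ : ButcherCharacter} {n : ℕ}
    (h : (n : ℕ∞) ≤ ψ.antisymmetricOrder) (τ : RTree) (hτ : τ.order ≤ n) :
    ψ (plus (X τ)) = 0 := by
  by_contra hne
  have h1 : ψ.antisymmetricOrder ≤ ((τ.order - 1 : ℕ) : ℕ∞) := by
    refine iSup₂_le fun k hk => ?_
    by_contra hlt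
    rw [not_le, Nat.cast_lt] at hlt
    exact hne (hk τ (by omega))
  have h2 := h.trans h1
  rw [Nat.cast_le] at h2
  have := τ.order_pos
  omega

end ButcherCharacter

/-! ### Cutting a single edge -/

namespace RTree

open Classical in
/-- The multiset of the pairs `(P, R)` of trees obtained by cutting one edge of a tree, where `R`
contains the root. -/
def edgeCuts : RTree → Multiset (RTree × RTree) :=
  fold fun s => s.bind fun p => (p.1, node ((s.map Prod.fst).erase p.1)) ::ₘ
    p.2.map fun q => (q.1, node (q.2 ::ₘ (s.map Prod.fst).erase p.1))

open Classical in
theorem edgeCuts_node (s : Multiset RTree) :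
    (node s).edgeCuts = s.bind fun t => (t, node (s.erase t)) ::ₘ
      t.edgeCuts.map fun q => (q.1, node (q.2 ::ₘ s.erase t)) := by
  have h : (s.map fun t => (t, t.edgeCuts)).map Prod.fst = s := by
    rw [Multiset.map_map]; exact Multiset.map_id s
  rw [edgeCuts, fold_node]
  change ((s.map fun t => (t, t.edgeCuts)).bind fun p =>
    (p.1, node (((s.map fun t => (t, t.edgeCuts)).map Prod.fst).erase p.1)) ::ₘ
    p.2.map fun q => (q.1, node (q.2 ::ₘ
      ((s.map fun t => (t, t.edgeCuts)).map Prod.fst).erase p.1))) = _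
  rw [h, Multiset.bind_map]
  rfl

theorem order_of_mem_edgeCuts (τ : RTree) :
    ∀ q ∈ τ.edgeCuts, q.1.order + q.2.order = τ.order := by
  classical
  induction τ using RTree.induction with
  | h s ih =>
    intro q hq
    rw [edgeCuts_node, Multiset.mem_bind] at hq
    obtain ⟨t, ht, hq⟩ := hq
    have h1 : t.order + ((s.erase t).map order).sum = (s.map order).sum := by
      conv_rhs => rw [← Multiset.cons_erase ht, Multiset.map_cons, Multiset.sum_cons]
    rcases Multiset.mem_cons.1 hq with rfl | hq
    · simp only [order_node]; omega
    · obtain ⟨p, hp, rfl⟩ := Multiset.mem_map.1 hq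
      have := ih t ht p hp
      simp only [order_node, Multiset.map_cons, Multiset.sum_cons]
      omega

end RTree

namespace BCK

open MvPolynomial hiding counit
open ButcherCharacter

/-! ### Infinitesimal characters and the derivations they define -/

/-- The infinitesimal character with given values on the trees. -/
def infinitesimal (a : RTree → ℝ) : BCK →ₗ[ℝ] ℝ :=
  counit.toLinearMap ∘ₗ (mkDerivation ℝ fun τ => (C (a τ) : BCK) : Derivation ℝ BCK BCK)

theorem infinitesimal_X (a : RTree → ℝ) (τ : RTree) : infinitesimal a (X τ) = a τ := by
  simp [infinitesimal, counit]

theorem infinitesimal_mul (a : RTree → ℝ) (x y : BCK) : infinitesimal a (x * y) =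
    infinitesimal a x * counit y + counit x * infinitesimal a y := by
  simp [infinitesimal]
  ring

/-- The contraction of the left factor of the coproduct with a linear functional. -/
def contract (φ : BCK →ₗ[ℝ] ℝ) : BCK →ₗ[ℝ] BCK :=
  (TensorProduct.lid ℝ BCK).toLinearMap ∘ₗ φ.rTensor BCK ∘ₗ comul.toLinearMap

/-- The convolution product of two linear functionals. -/
def convFunctional (φ χ : BCK →ₗ[ℝ] ℝ) : BCK →ₗ[ℝ] ℝ :=
  LinearMap.mul' ℝ ℝ ∘ₗ TensorProduct.map φ χ ∘ₗ comul.toLinearMap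

theorem convFunctional_eq (φ χ : BCK →ₗ[ℝ] ℝ) :
    convFunctional φ χ = χ ∘ₗ contract φ := by
  refine LinearMap.ext fun x => ?_
  simp only [convFunctional, contract, LinearMap.comp_apply]
  induction comul.toLinearMap x with
  | zero => simp
  | add z w hz hw => simp only [map_add, hz, hw]
  | tmul p q => simp

/-- Coassociativity, read through contractions; the order of the factors is reversed. -/
theorem contract_convFunctional (φ χ : BCK →ₗ[ℝ] ℝ) :
    contract (convFunctional φ χ) = contract χ ∘ₗ contract φ := by
  refine LinearMap.ext fun x => ?_
  have h1 : ∀ z : BCK ⊗[ℝ] BCK,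
      TensorProduct.lid ℝ BCK ((convFunctional φ χ).rTensor BCK z) =
      TensorProduct.lid ℝ BCK (χ.rTensor BCK (TensorProduct.lid ℝ (BCK ⊗[ℝ] BCK)
        (φ.rTensor (BCK ⊗[ℝ] BCK)
          (TensorProduct.assoc ℝ BCK BCK BCK (comul.toLinearMap.rTensor BCK z))))) := by
    intro z
    induction z with
    | zero => simp
    | add z w hz hw => simp only [map_add, hz, hw]
    | tmul p q =>
      simp only [convFunctional, LinearMap.rTensor_tmul, LinearMap.comp_apply,
        AlgHom.toLinearMap_apply]
      induction comul p with
      | zero => simp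
      | add z w hz hw => simp only [map_add, TensorProduct.add_tmul, hz, hw]
      | tmul u v => simp [TensorProduct.smul_tmul']
  have h2 : ∀ z : BCK ⊗[ℝ] BCK,
      TensorProduct.lid ℝ (BCK ⊗[ℝ] BCK)
        (φ.rTensor (BCK ⊗[ℝ] BCK) (comul.toLinearMap.lTensor BCK z)) =
      comul (TensorProduct.lid ℝ BCK (φ.rTensor BCK z)) := by
    intro z
    induction z with
    | zero => simp
    | add z w hz hw => simp only [map_add, hz, hw]
    | tmul p q => simp
  have h3 := h1 (comul x)
  rw [coassoc, h2] at h3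
  exact h3

theorem contract_bplus (φ : BCK →ₗ[ℝ] ℝ) (x : BCK) :
    contract φ (bplus x) = C (φ (bplus x)) + bplus (contract φ x) := by
  simp only [contract, LinearMap.comp_apply, AlgHom.toLinearMap_apply, comul_bplus, map_add]
  congr 1
  · simp [C_eq_smul_one]
  · induction comul x with
    | zero => simp
    | add z w hz hw => simp only [map_add, hz, hw]
    | tmul p q => simp

theorem contract_counit : contract counit.toLinearMap = LinearMap.id := by
  have h : ((Algebra.TensorProduct.lid ℝ BCK).toAlgHom.comp
      (Algebra.TensorProduct.map counit (AlgHom.id ℝ BCK))).comp comul = AlgHom.id ℝ BCK := by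
    refine algHom_ext_node fun s ih => ?_
    change contract counit.toLinearMap (forest s) = forest s at ih
    change contract counit.toLinearMap (X (RTree.node s)) = X (RTree.node s)
    rw [← bplus_forest, contract_bplus, ih]
    simp
  exact congrArg AlgHom.toLinearMap h

/-- An infinitesimal character is a derivation over the counit, and contraction with the counit is
the identity, so the Leibniz rule results. -/
theorem contract_infinitesimal_mul (a : RTree → ℝ) (x y : BCK) :
    contract (infinitesimal a) (x * y) =
      x * contract (infinitesimal a) y + y * contract (infinitesimal a) x := by
  have h : ∀ z w : BCK ⊗[ℝ] BCK,
      TensorProduct.lid ℝ BCK ((infinitesimal a).rTensor BCK (z * w)) =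
      TensorProduct.lid ℝ BCK (counit.toLinearMap.rTensor BCK z) *
        TensorProduct.lid ℝ BCK ((infinitesimal a).rTensor BCK w) +
      TensorProduct.lid ℝ BCK (counit.toLinearMap.rTensor BCK w) *
        TensorProduct.lid ℝ BCK ((infinitesimal a).rTensor BCK z) := by
    intro z w
    induction z with
    | zero => simp
    | add z z' hz hz' => simp only [map_add, add_mul, mul_add, hz, hz']; abel
    | tmul p q =>
      induction w with
      | zero => simp
      | add z z' hz hz' => simp only [map_add, add_mul, mul_add, hz, hz']; abel
      | tmul u v =>
        simp only [Algebra.TensorProduct.tmul_mul_tmul, LinearMap.rTensor_tmul,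
          TensorProduct.lid_tmul, infinitesimal_mul, AlgHom.toLinearMap_apply, smul_eq_C_mul,
          map_add, map_mul]
        ring
  have h1 := h (comul x) (comul y)
  rw [← map_mul] at h1
  have h2 : ∀ x, TensorProduct.lid ℝ BCK (counit.toLinearMap.rTensor BCK (comul x)) = x :=
    LinearMap.congr_fun contract_counit
  rw [h2, h2] at h1
  exact h1

/-- The derivation `X τ ↦ a(τ) + ∑ a(P) R`, where the sum is over the edge cuts of `τ`. -/
def edgeDerivation (a : RTree → ℝ) : Derivation ℝ BCK BCK :=
  mkDerivation ℝ fun τ => C (a τ) + (τ.edgeCuts.map fun q => a q.1 • (X q.2 : BCK)).sum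

theorem edgeDerivation_X (a : RTree → ℝ) (τ : RTree) : edgeDerivation a (X τ) =
    C (a τ) + (τ.edgeCuts.map fun q => a q.1 • (X q.2 : BCK)).sum := by
  rw [edgeDerivation, mkDerivation_X]

open Classical in
theorem derivation_forest (D : Derivation ℝ BCK BCK) (s : Multiset RTree) :
    D (forest s) = (s.map fun t => D (X t) * forest (s.erase t)).sum := by
  induction s using Multiset.induction with
  | empty => simp
  | cons t s ih =>
    rw [forest_cons, D.leibniz, ih, Multiset.map_cons, Multiset.sum_cons, Multiset.erase_cons_head,
      smul_eq_mul, smul_eq_mul, add_comm, mul_comm (forest s), ← Multiset.sum_map_mul_left]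
    congr 2
    refine Multiset.map_congr rfl fun u hu => ?_
    rw [Multiset.erase_cons_tail_of_mem hu, forest_cons]
    ring

theorem edgeDerivation_node (a : RTree → ℝ) (s : Multiset RTree) :
    edgeDerivation a (X (RTree.node s)) =
      C (a (RTree.node s)) + bplus (edgeDerivation a (forest s)) := by
  classical
  rw [edgeDerivation_X, derivation_forest, RTree.edgeCuts_node, map_multiset_sum,
    Multiset.map_bind, Multiset.sum_bind, Multiset.map_map]
  congr 2
  refine Multiset.map_congr rfl fun t _ => ?_
  rw [Function.comp_apply, edgeDerivation_X, add_mul, map_add, Multiset.map_cons,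
    Multiset.sum_cons, Multiset.map_map, ← Multiset.sum_map_mul_right, map_multiset_sum,
    Multiset.map_map, ← smul_eq_C_mul, map_smul, bplus_forest]
  congr 2
  refine Multiset.map_congr rfl fun q _ => ?_
  simp [← forest_cons]

/-- Infinitesimal characters vanish on the empty forest and on products of several trees, so only
cuts pruning a single tree survive. Formally, both sides are derivations satisfying the same
recursion along `B₊`. -/
theorem contract_infinitesimal (a : RTree → ℝ) :
    contract (infinitesimal a) = (edgeDerivation a).toLinearMap := by
  have h : Derivation.mk' (contract (infinitesimal a)) (fun x y => by
      rw [contract_infinitesimal_mul]; rfl) = edgeDerivation a := by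
    refine derivation_ext fun τ => ?_
    induction τ using RTree.induction with
    | h s ih =>
      classical
      have h1 : contract (infinitesimal a) (forest s) = edgeDerivation a (forest s) := by
        refine (derivation_forest (Derivation.mk' (contract (infinitesimal a)) fun x y => by
          rw [contract_infinitesimal_mul]; rfl) s).trans ?_
        rw [derivation_forest]
        exact congrArg _ (Multiset.map_congr rfl fun t ht => congrArg (· * _) (ih t ht))
      rw [Derivation.coe_mk', edgeDerivation_node, ← bplus_forest, contract_bplus, h1,
        bplus_forest, infinitesimal_X]
  rw [← h]
  rfl

theorem edgeDerivation_neg (a : RTree → ℝ) : edgeDerivation (-a) = -edgeDerivation a := by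
  refine derivation_ext fun τ => ?_
  rw [Derivation.neg_apply, edgeDerivation_X, edgeDerivation_X, neg_add, ← Multiset.sum_map_neg]
  simp

/-- The convolution powers of an infinitesimal character. -/
def infinitesimalPow (a : RTree → ℝ) (i : ℕ) : BCK →ₗ[ℝ] ℝ :=
  counit.toLinearMap ∘ₗ ((edgeDerivation a).toLinearMap : Module.End ℝ BCK) ^ i

theorem infinitesimalPow_zero (a : RTree → ℝ) (x : BCK) :
    infinitesimalPow a 0 x = counit x := rfl

theorem infinitesimalPow_succ (a : RTree → ℝ) (i : ℕ) (x : BCK) :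
    infinitesimalPow a (i + 1) x = infinitesimalPow a i (edgeDerivation a x) := by
  simp only [infinitesimalPow, pow_succ]
  rfl

theorem infinitesimalPow_neg (a : RTree → ℝ) (i : ℕ) (x : BCK) :
    infinitesimalPow (-a) i x = (-1) ^ i * infinitesimalPow a i x := by
  induction i generalizing x with
  | zero => simp [infinitesimalPow_zero]
  | succ i ih =>
    rw [infinitesimalPow_succ, infinitesimalPow_succ, ih, edgeDerivation_neg,
      Derivation.neg_apply, map_neg, pow_succ]
    ring

/-- Justifies the name convolution power: contraction with it iterates the derivation, whence
exponents add under convolution. -/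
theorem contract_infinitesimalPow (a : RTree → ℝ) (i : ℕ) :
    contract (infinitesimalPow a i) =
      ((edgeDerivation a).toLinearMap : Module.End ℝ BCK) ^ i := by
  induction i with
  | zero => exact contract_counit
  | succ i ih =>
    have h : infinitesimalPow a (i + 1) =
        convFunctional (infinitesimal a) (infinitesimalPow a i) := by
      rw [convFunctional_eq, contract_infinitesimal]
      exact LinearMap.ext fun x => infinitesimalPow_succ a i x
    rw [h, contract_convFunctional, ih, contract_infinitesimal, pow_succ]
    rfl

theorem convFunctional_infinitesimalPow (a : RTree → ℝ) (i j : ℕ) :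
    convFunctional (infinitesimalPow a i) (infinitesimalPow a j) =
      infinitesimalPow a (i + j) := by
  rw [convFunctional_eq, contract_infinitesimalPow, infinitesimalPow, infinitesimalPow, add_comm,
    pow_add]
  rfl

theorem infinitesimalPow_one_eq_zero (a : RTree → ℝ) {i : ℕ} (hi : i ≠ 0) :
    infinitesimalPow a i 1 = 0 := by
  obtain ⟨i, rfl⟩ := Nat.exists_eq_succ_of_ne_zero hi
  simp [infinitesimalPow_succ]

theorem infinitesimalPow_one_X (a : RTree → ℝ) (τ : RTree) :
    infinitesimalPow a 1 (X τ) = a τ := by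
  rw [infinitesimalPow_succ, infinitesimalPow_zero, edgeDerivation_X, map_add, map_multiset_sum,
    Multiset.map_map]
  simp [counit]

theorem infinitesimalPow_succ_X (a : RTree → ℝ) {i : ℕ} (hi : i ≠ 0) (τ : RTree) :
    infinitesimalPow a (i + 1) (X τ) =
      (τ.edgeCuts.map fun q => a q.1 * infinitesimalPow a i (X q.2)).sum := by
  rw [infinitesimalPow_succ, edgeDerivation_X, map_add, map_multiset_sum, Multiset.map_map,
    C_eq_smul_one, map_smul, infinitesimalPow_one_eq_zero a hi]
  simp

/-- Every further factor `a` removes a tree with at least one vertex. This makes the exponential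
series finite on each tree. -/
theorem infinitesimalPow_X_eq_zero (a : RTree → ℝ) {i : ℕ} {τ : RTree} (h : τ.order < i) :
    infinitesimalPow a i (X τ) = 0 := by
  induction i generalizing τ with
  | zero => omega
  | succ i ih =>
    have := τ.order_pos
    rw [infinitesimalPow_succ_X a (by omega)]
    refine Multiset.sum_eq_zero fun x hx => ?_
    obtain ⟨q, hq, rfl⟩ := Multiset.mem_map.1 hx
    have h1 := τ.order_of_mem_edgeCuts q hq
    have h2 := q.1.order_pos
    rw [ih (by omega), mul_zero]

theorem infinitesimalPow_X_congr {a a' : RTree → ℝ} (i : ℕ) {τ : RTree}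
    (h : ∀ t : RTree, t.order ≤ τ.order → a t = a' t) :
    infinitesimalPow a i (X τ) = infinitesimalPow a' i (X τ) := by
  induction i generalizing τ with
  | zero => rfl
  | succ i ih =>
    rcases Nat.eq_zero_or_pos i with rfl | hi
    · rw [infinitesimalPow_one_X, infinitesimalPow_one_X, h τ le_rfl]
    · rw [infinitesimalPow_succ_X a hi.ne', infinitesimalPow_succ_X a' hi.ne']
      refine congrArg _ (Multiset.map_congr rfl fun q hq => ?_)
      have h1 := τ.order_of_mem_edgeCuts q hq
      rw [h q.1 (by omega), ih fun t ht => h t (by omega)]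

/-- Only the first power sees `a τ`; for exponents at least `2` both trees of an edge cut are
smaller, and the zeroth power is the counit. -/
theorem infinitesimalPow_X_congr_of_lt {a a' : RTree → ℝ} {i : ℕ} (hi : i ≠ 1) {τ : RTree}
    (h : ∀ t : RTree, t.order < τ.order → a t = a' t) :
    infinitesimalPow a i (X τ) = infinitesimalPow a' i (X τ) := by
  rcases i with _ | i
  · rfl
  · have hi' : i ≠ 0 := by omega
    rw [infinitesimalPow_succ_X a hi', infinitesimalPow_succ_X a' hi']
    refine congrArg _ (Multiset.map_congr rfl fun q hq => ?_)
    have h1 := τ.order_of_mem_edgeCuts q hq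
    have h2 := q.1.order_pos
    have h3 := q.2.order_pos
    rw [h q.1 (by omega), infinitesimalPow_X_congr i fun t ht => h t (by omega)]

/-- The iterated Leibniz rule, divided by `n!` so that it becomes a Cauchy product of coefficients.
-/
theorem infinitesimalPow_mul (a : RTree → ℝ) (n : ℕ) (x y : BCK) :
    infinitesimalPow a n (x * y) / n.factorial =
      ∑ p ∈ Finset.HasAntidiagonal.antidiagonal n,
        (infinitesimalPow a p.1 x / p.1.factorial) *
          (infinitesimalPow a p.2 y / p.2.factorial) := by
  have h : ∀ (n : ℕ) (x y : BCK), infinitesimalPow a n (x * y) =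
      ∑ p ∈ Finset.HasAntidiagonal.antidiagonal n,
        n.choose p.1 • (infinitesimalPow a p.1 x * infinitesimalPow a p.2 y) := by
    intro n
    induction n with
    | zero => simp [infinitesimalPow_zero]
    | succ n ih =>
      intro x y
      rw [Finset.sum_antidiagonal_choose_succ_nsmul
        (fun i j => infinitesimalPow a i x * infinitesimalPow a j y), infinitesimalPow_succ,
        Derivation.leibniz, map_add, smul_eq_mul, smul_eq_mul, mul_comm y, ih, ih]
      simp only [infinitesimalPow_succ]
      congr 1
      refine Finset.sum_congr rfl fun p hp => ?_
      rw [Nat.choose_symm_of_eq_add (Finset.HasAntidiagonal.mem_antidiagonal.1 hp).symm]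
  rw [h, Finset.sum_div]
  refine Finset.sum_congr rfl fun p hp => ?_
  rw [← Finset.HasAntidiagonal.mem_antidiagonal.1 hp, nsmul_eq_mul, Nat.cast_add_choose]
  have := Nat.factorial_ne_zero (p.1 + p.2)
  field_simp

/-! ### The exponential of an infinitesimal character -/

/-- The one-parameter group `t ↦ exp(t a)`, as a polynomial in `t`. -/
def expPoly (a : RTree → ℝ) : BCK →ₐ[ℝ] Polynomial ℝ :=
  aeval fun τ => ∑ i ∈ Finset.range (τ.order + 1),
    Polynomial.monomial i (infinitesimalPow a i (X τ) / i.factorial)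

/-- The definition prescribes the series on trees only; the Cauchy product formula propagates it to
all of the algebra, where the degree is not bounded in advance. -/
theorem coeff_expPoly (a : RTree → ℝ) (i : ℕ) (x : BCK) :
    (expPoly a x).coeff i = infinitesimalPow a i x / i.factorial := by
  induction x using MvPolynomial.induction_on generalizing i with
  | C r =>
    rw [← algebraMap_eq, AlgHom.commutes, Polynomial.algebraMap_apply, Polynomial.coeff_C,
      Algebra.algebraMap_eq_smul_one r, Algebra.algebraMap_eq_smul_one r, map_smul]
    split_ifs with h
    · simp [h, infinitesimalPow_zero]
    · simp [infinitesimalPow_one_eq_zero a h]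
  | add p q hp hq => rw [map_add, Polynomial.coeff_add, hp, hq, map_add, add_div]
  | mul_X p τ hp =>
    rw [map_mul, Polynomial.coeff_mul, infinitesimalPow_mul]
    refine Finset.sum_congr rfl fun p _ => ?_
    rw [hp, expPoly, aeval_X, Polynomial.finsetSum_coeff]
    simp only [Polynomial.coeff_monomial, Finset.sum_ite_eq', Finset.mem_range]
    split_ifs with h
    · rfl
    · rw [infinitesimalPow_X_eq_zero a (by omega), zero_div]

end BCK

namespace ButcherCharacter

open MvPolynomial hiding counit
open BCK

/-- The exponential of an infinitesimal character. -/
def exp (a : RTree → ℝ) : ButcherCharacter := (Polynomial.aeval (1 : ℝ)).comp (expPoly a)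

theorem exp_X (a : RTree → ℝ) (τ : RTree) : exp a (X τ) =
    ∑ i ∈ Finset.range (τ.order + 1), infinitesimalPow a i (X τ) / i.factorial := by
  simp [exp, expPoly, Polynomial.eval_finsetSum]

/-- The exponential is triangular: `a τ` enters `exp a (X τ)` only through the term `i = 1`, with
coefficient one. -/
theorem exp_X_sub_exp_X {a a' : RTree → ℝ} {τ : RTree}
    (h : ∀ t : RTree, t.order < τ.order → a t = a' t) :
    exp a (X τ) - exp a' (X τ) = a τ - a' τ := by
  have := τ.order_pos
  rw [exp_X, exp_X, ← Finset.sum_sub_distrib, Finset.sum_eq_single 1]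
  · simp [infinitesimalPow_one_X]
  · intro i _ hi
    rw [infinitesimalPow_X_congr_of_lt hi h, sub_self]
  · simp
    omega

theorem mul_exp_exp_neg (a : RTree → ℝ) : mul (exp a) (exp (-a)) = counit := by
  set Φ : BCK ⊗[ℝ] BCK →ₐ[ℝ] Polynomial ℝ :=
    Algebra.TensorProduct.lift (expPoly a) (expPoly (-a)) fun _ _ => Commute.all _ _
  have h1 : ∀ (n : ℕ) (z : BCK ⊗[ℝ] BCK), (Φ z).coeff n =
      ∑ p ∈ Finset.HasAntidiagonal.antidiagonal n,
        ((-1) ^ p.2 / (p.1.factorial * p.2.factorial)) * LinearMap.mul' ℝ ℝ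
          (TensorProduct.map (infinitesimalPow a p.1) (infinitesimalPow a p.2) z) := by
    intro n z
    induction z with
    | zero => simp
    | add z w hz hw =>
      simp only [map_add, Polynomial.coeff_add, hz, hw, mul_add, Finset.sum_add_distrib]
    | tmul x y =>
      simp only [Φ, Algebra.TensorProduct.lift_tmul, Polynomial.coeff_mul, coeff_expPoly,
        infinitesimalPow_neg, TensorProduct.map_tmul, LinearMap.mul'_apply]
      refine Finset.sum_congr rfl fun p _ => ?_
      ring
  have h2 : ∀ x, Φ (comul x) = Polynomial.C (counit x) := by
    intro x
    ext n
    -- All terms of degree `n` contain the same convolution power, and their scalar factors add up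
    -- to `(1 - 1)^n / n!`.
    have h3 : (Φ (comul x)).coeff n = (∑ p ∈ Finset.HasAntidiagonal.antidiagonal n,
        ((-1 : ℝ) ^ p.2 / (p.1.factorial * p.2.factorial))) * infinitesimalPow a n x := by
      rw [h1, Finset.sum_mul]
      refine Finset.sum_congr rfl fun p hp => ?_
      rw [← Finset.HasAntidiagonal.mem_antidiagonal.1 hp, ← convFunctional_infinitesimalPow]
      rfl
    have h4 : ∑ p ∈ Finset.HasAntidiagonal.antidiagonal n,
        ((-1 : ℝ) ^ p.2 / (p.1.factorial * p.2.factorial)) =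
        (1 + -1) ^ n / n.factorial := by
      rw [(Commute.all (1 : ℝ) (-1)).add_pow', Finset.sum_div]
      refine Finset.sum_congr rfl fun p hp => ?_
      rw [← Finset.HasAntidiagonal.mem_antidiagonal.1 hp, one_pow, one_mul, nsmul_eq_mul,
        Nat.cast_add_choose]
      have := Nat.factorial_ne_zero (p.1 + p.2)
      field_simp
    rw [h3, h4, Polynomial.coeff_C]
    rcases Nat.eq_zero_or_pos n with rfl | hn
    · simp [infinitesimalPow_zero]
    · simp [hn.ne']
  refine AlgHom.ext fun x => ?_
  have h5 : ∀ z, Algebra.TensorProduct.lift (exp a) (exp (-a)) (fun _ _ => Commute.all _ _) z =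
      Polynomial.aeval (1 : ℝ) (Φ z) := by
    intro z
    induction z with
    | zero => simp
    | add z w hz hw => simp only [map_add, hz, hw]
    | tmul x y => simp [Φ, exp]
  rw [mul, AlgHom.comp_apply, h5, h2]
  simp

/-- Every character is an exponential, up to any given order. -/
theorem exists_exp_X_eq (ψ : ButcherCharacter) (n : ℕ) :
    ∃ a : RTree → ℝ, ∀ τ : RTree, τ.order ≤ n → exp a (X τ) = ψ (X τ) := by
  induction n with
  | zero => exact ⟨0, fun τ hτ => by have := τ.order_pos; omega⟩
  | succ n ih =>
    obtain ⟨a, ha⟩ := ih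
    -- A correction on trees of order `n + 1` leaves the smaller ones untouched and changes `exp a`
    -- there by exactly the correction.
    refine ⟨fun τ => a τ + (if τ.order = n + 1 then ψ (X τ) - exp a (X τ) else 0),
      fun τ hτ => ?_⟩
    have := exp_X_sub_exp_X (τ := τ) (a := fun τ => a τ +
      (if τ.order = n + 1 then ψ (X τ) - exp a (X τ) else 0)) (a' := a) (fun t ht => by
        rw [if_neg (by omega), add_zero])
    split_ifs at this with h
    · linarith
    · have := ha τ (by omega)
      linarith

theorem exp_bar_X (a : RTree → ℝ) (τ : RTree) :
    exp (fun t => (-1) ^ t.order * a t) (X τ) = (exp a).bar (X τ) := by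
  -- Orders add under an edge cut, so the sign `(-1)^{|τ|}` factors through the recursion for the
  -- powers.
  have h : ∀ (i : ℕ) (τ : RTree), infinitesimalPow (fun t => (-1) ^ t.order * a t) i (X τ) =
      (-1) ^ τ.order * infinitesimalPow a i (X τ) := by
    intro i
    induction i with
    | zero => intro τ; simp [infinitesimalPow_zero]
    | succ i ih =>
      intro τ
      rcases Nat.eq_zero_or_pos i with rfl | hi
      · rw [infinitesimalPow_one_X, infinitesimalPow_one_X]
      · rw [infinitesimalPow_succ_X _ hi.ne', infinitesimalPow_succ_X _ hi.ne',
          ← Multiset.sum_map_mul_left]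
        refine congrArg _ (Multiset.map_congr rfl fun q hq => ?_)
        rw [ih, ← τ.order_of_mem_edgeCuts q hq, pow_add]
        ring
  rw [bar_X, exp_X, exp_X, Finset.mul_sum]
  exact Finset.sum_congr rfl fun i _ => by rw [h, mul_div_assoc]

/-- The logarithm of a symmetric character vanishes on the trees of even order. -/
theorem eq_zero_of_even_order {ψ : ButcherCharacter} {a : RTree → ℝ} {n : ℕ}
    (ha : ∀ τ : RTree, τ.order ≤ n → exp a (X τ) = ψ (X τ))
    (hψ : ∀ τ : RTree, τ.order ≤ n → mul ψ ψ.bar (X τ) = 0) (τ : RTree) (hτ : τ.order ≤ n)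
    (he : Even τ.order) : a τ = 0 := by
  induction hk : τ.order using Nat.strong_induction_on generalizing τ with
  | _ k ih =>
    subst hk
    -- Below the order of `τ` the identity `ā = -a` holds by the sign for odd orders and by
    -- induction for even ones.
    have h1 : ∀ t : RTree, t.order < τ.order → (-1) ^ t.order * a t = (-a) t := by
      intro t ht
      rcases Nat.even_or_odd t.order with h | h
      · rw [Pi.neg_apply, ih _ ht t (by omega) h rfl]; simp
      · simp [h.neg_one_pow]
    have h2 : ∀ t : RTree, t.order ≤ n →
        ψ.bar (X t) = exp (fun t => (-1) ^ t.order * a t) (X t) := by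
      intro t ht
      rw [exp_bar_X, bar_X, bar_X, ha t ht]
    -- Both `ψ * ψ̄` and `exp(a) * exp(-a)` vanish at `τ`, and the factors agree on smaller trees.
    -- The comparison at `τ` leaves `0 = ā(τ) + a(τ)`, which is `2 a(τ)` for even order.
    have h3 := mul_X_sub_mul_X (τ := τ) (φ := ψ) (φ' := exp a) (χ := ψ.bar) (χ' := exp (-a))
      (fun t ht => (ha t (by omega)).symm) (fun t ht => by
        rw [h2 t (by omega), ← sub_eq_zero, exp_X_sub_exp_X fun u hu => h1 u (by omega), h1 t ht,
          sub_self])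
    rw [hψ τ hτ, mul_exp_exp_neg, counit_X, ha τ hτ, h2 τ hτ, exp_X_sub_exp_X h1,
      he.neg_one_pow, Pi.neg_apply] at h3
    linarith

end ButcherCharacter

namespace RTree

/-! ### Grafting and symmetry factors -/

open Classical in
/-- The multiset of the trees obtained by joining the root of `τ₁` to a vertex of a tree. -/
def graft (τ₁ : RTree) : RTree → Multiset RTree :=
  fold fun s => node (τ₁ ::ₘ s.map Prod.fst) ::ₘ
    s.bind fun p => p.2.map fun g => node (g ::ₘ (s.map Prod.fst).erase p.1)

open Classical in
theorem graft_node (τ₁ : RTree) (s : Multiset RTree) :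
    graft τ₁ (node s) = node (τ₁ ::ₘ s) ::ₘ
      s.bind fun t => (graft τ₁ t).map fun g => node (g ::ₘ s.erase t) := by
  have h : (s.map fun t => (t, graft τ₁ t)).map Prod.fst = s := by
    rw [Multiset.map_map]; exact Multiset.map_id s
  rw [graft, fold_node]
  change node (τ₁ ::ₘ (s.map fun t => (t, graft τ₁ t)).map Prod.fst) ::ₘ
    ((s.map fun t => (t, graft τ₁ t)).bind fun p =>
      p.2.map fun g => node (g ::ₘ ((s.map fun t => (t, graft τ₁ t)).map Prod.fst).erase p.1)) = _
  rw [h, Multiset.bind_map]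
  rfl

theorem order_of_mem_graft (τ₁ τ : RTree) :
    ∀ g ∈ graft τ₁ τ, g.order = τ₁.order + τ.order := by
  classical
  induction τ using RTree.induction with
  | h s ih =>
    intro g hg
    rw [graft_node] at hg
    rcases Multiset.mem_cons.1 hg with rfl | hg
    · simp only [order_node, Multiset.map_cons, Multiset.sum_cons]; omega
    · obtain ⟨t, ht, hg⟩ := Multiset.mem_bind.1 hg
      obtain ⟨u, hu, rfl⟩ := Multiset.mem_map.1 hg
      have h1 : t.order + ((s.erase t).map order).sum = (s.map order).sum := by
        conv_rhs => rw [← Multiset.cons_erase ht, Multiset.map_cons, Multiset.sum_cons]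
      have := ih t ht u hu
      simp only [order_node, Multiset.map_cons, Multiset.sum_cons]
      omega

open Classical in
theorem symmetryFactor_node_cons (t : RTree) (s : Multiset RTree) :
    (node (t ::ₘ s)).symmetryFactor =
      (s.count t + 1) * t.symmetryFactor * (node s).symmetryFactor := by
  have h : ∀ s' : Multiset RTree, s' ≤ t ::ₘ s → (node s').symmetryFactor =
      ∏ u ∈ insert t s.toFinset, (s'.count u).factorial * u.symmetryFactor ^ s'.count u := by
    intro s' hs'
    rw [symmetryFactor_node]
    refine Finset.prod_subset ?_ ?_
    · rw [← Multiset.toFinset_cons]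
      exact Multiset.toFinset_subset.2 (Multiset.subset_of_le hs')
    · intro u _ hu
      rw [Multiset.mem_toFinset] at hu
      simp [Multiset.count_eq_zero_of_notMem hu]
  rw [h _ le_rfl, h _ (Multiset.le_cons_self s t),
    ← Finset.mul_prod_erase _ _ (Finset.mem_insert_self t s.toFinset),
    ← Finset.mul_prod_erase _ (fun u => (s.count u).factorial * u.symmetryFactor ^ s.count u)
      (Finset.mem_insert_self t s.toFinset),
    Finset.prod_congr rfl fun u hu => by
      rw [Multiset.count_cons_of_ne (Finset.ne_of_mem_erase hu)],
    Multiset.count_cons_self, Nat.factorial_succ, pow_succ]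
  ring

open Classical in
theorem symmetryFactor_node_of_mem {t : RTree} {s : Multiset RTree} (h : t ∈ s) :
    (node s).symmetryFactor =
      s.count t * t.symmetryFactor * (node (s.erase t)).symmetryFactor := by
  obtain ⟨s, rfl⟩ := Multiset.exists_cons_of_mem h
  rw [Multiset.erase_cons_head, Multiset.count_cons_self, symmetryFactor_node_cons]

theorem symmetryFactor_pos (τ : RTree) : 0 < τ.symmetryFactor := by
  classical
  induction τ using RTree.induction with
  | h s ih =>
    rw [symmetryFactor_node]
    exact Finset.prod_pos fun t ht =>
      Nat.mul_pos (Nat.factorial_pos _) (pow_pos (ih t (Multiset.mem_toFinset.1 ht)) _)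

open Classical in
-- The equation `q.2 ::ₘ r = s` says that `q.2` is a branch in `s` whose removal leaves `r`; the sum
-- runs over the distinct candidates.
theorem count_map_node_cons {β : Type*} (p : β) (M : Multiset (β × RTree))
    (r s : Multiset RTree) :
    (M.map fun q => (q.1, node (q.2 ::ₘ r))).count (p, node s) =
      ∑ g ∈ s.toFinset, if s.erase g = r then M.count (p, g) else 0 := by
  induction M using Multiset.induction with
  | empty => simp
  | cons q M ih =>
    rw [Multiset.map_cons, Multiset.count_cons, ih]
    have h : (if (p, node s) = (q.1, node (q.2 ::ₘ r)) then 1 else 0) =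
        ∑ g ∈ s.toFinset, if s.erase g = r then (if (p, g) = q then 1 else 0) else 0 := by
      split_ifs with h
      · rw [Prod.mk.injEq, node_injective.eq_iff] at h
        obtain ⟨rfl, rfl⟩ := h
        rw [Finset.sum_eq_single q.2]
        · simp
        · intro g _ hg
          rw [if_neg (c := (q.1, g) = q) fun h => hg (congrArg Prod.snd h), ite_self]
        · simp
      · symm
        refine Finset.sum_eq_zero fun g hg => ?_
        rw [Multiset.mem_toFinset] at hg
        split_ifs with h1 h2
        · subst h2
          exact (h (by rw [← h1, Multiset.cons_erase hg])).elim
        · rfl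
        · rfl
    rw [h, ← Finset.sum_add_distrib]
    refine Finset.sum_congr rfl fun g _ => ?_
    split_ifs <;> simp_all

open Classical in
theorem count_map_node_cons' (M : Multiset RTree) (r s : Multiset RTree) :
    (M.map fun g => node (g ::ₘ r)).count (node s) =
      ∑ g ∈ s.toFinset, if s.erase g = r then M.count g else 0 := by
  have hinj : Function.Injective (Prod.mk single : RTree → RTree × RTree) :=
    fun _ _ h => congrArg Prod.snd h
  have h := count_map_node_cons single (M.map (Prod.mk single)) r s
  rw [Multiset.map_map] at h
  simp only [Multiset.count_map_eq_count' _ _ hinj] at h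
  rw [← h, ← Multiset.count_map_eq_count' _ _ hinj, Multiset.map_map]
  rfl

open Classical in
/-- Grafting is adjoint to cutting edges. -/
theorem symmetryFactor_mul_count_graft (τ₁ τ₂ τ : RTree) :
    τ.symmetryFactor * (graft τ₁ τ₂).count τ =
      τ₁.symmetryFactor * τ₂.symmetryFactor * τ.edgeCuts.count (τ₁, τ₂) := by
  induction τ₂ using RTree.induction generalizing τ with
  | h s₂ ih =>
    obtain ⟨s, rfl⟩ : ∃ s, node s = τ := ⟨_, node_branches τ⟩
    rw [graft_node, edgeCuts_node, Multiset.count_cons, Multiset.count_bind, Multiset.count_bind]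
    simp only [Multiset.count_cons, Multiset.sum_map_add, count_map_node_cons,
      count_map_node_cons', node_injective.eq_iff, Prod.mk.injEq]
    rw [add_comm, mul_add, mul_add, add_comm (_ * _)]
    congr 1
    -- Grafting inside a branch `t` to obtain `g` is matched with cutting inside the branch `g` to
    -- leave `t`; removing either branch leaves the same forest, so the induction hypothesis for `t`
    -- applies.
    · rw [Finset.sum_multiset_map_count, Finset.sum_multiset_map_count, Finset.mul_sum,
        Finset.mul_sum]
      simp only [smul_eq_mul, Finset.mul_sum]
      rw [Finset.sum_comm]
      refine Finset.sum_congr rfl fun g hg => Finset.sum_congr rfl fun t ht => ?_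
      rw [Multiset.mem_toFinset] at hg ht
      by_cases h : s.erase g = s₂.erase t
      · rw [if_pos h, if_pos h.symm, symmetryFactor_node_of_mem hg, symmetryFactor_node_of_mem ht,
          h]
        calc _ = s.count g * (node (s₂.erase t)).symmetryFactor * s₂.count t *
              (g.symmetryFactor * (graft τ₁ t).count g) := by ring
          _ = _ := by rw [ih t ht g]; ring
      · rw [if_neg h, if_neg (Ne.symm h)]; simp
    -- Grafting at the root is matched with cutting an edge at the root; the multiplicity of `τ₁`
    -- comes from the ratio of symmetry factors.
    · by_cases h : s = τ₁ ::ₘ s₂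
      · subst h
        rw [if_pos rfl, Finset.sum_multiset_map_count, Finset.sum_eq_single τ₁,
          symmetryFactor_node_cons]
        · simp
          ring
        · intro g _ hg
          rw [if_neg fun h => hg h.1.symm, smul_zero]
        · simp
      · rw [if_neg h, mul_zero, Multiset.sum_eq_zero, mul_zero]
        intro x hx
        obtain ⟨t, ht, rfl⟩ := Multiset.mem_map.1 hx
        rw [if_neg]
        rintro ⟨rfl, rfl⟩
        exact h (Multiset.cons_erase ht).symm

/-! ### Derivatives of elementary differentials -/

variable {E : Type} [NormedAddCommGroup E] [NormedSpace ℝ E] {f : E → E}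

theorem exists_node_ofFn (τ : RTree) :
    ∃ (k : ℕ) (w : Fin k → RTree), τ = node (List.ofFn w : List RTree) :=
  ⟨_, τ.branches.toList.get, by rw [List.ofFn_get, Multiset.coe_toList, node_branches]⟩

theorem elementaryDifferential_node_ofFn (hf : ContDiff ℝ ∞ f) {k : ℕ} (w : Fin k → RTree)
    (y : E) : elementaryDifferential f (node (List.ofFn w : List RTree)) y =
      iteratedFDeriv ℝ k f y fun i => elementaryDifferential f (w i) y := by
  rw [elementaryDifferential_node hf]
  have : ∀ (n : ℕ) (hn : n = k) (v : Fin n → E)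
      (_ : ∀ i, v i = elementaryDifferential f (w (i.cast hn)) y),
      iteratedFDeriv ℝ n f y v =
        iteratedFDeriv ℝ k f y fun i => elementaryDifferential f (w i) y := by
    rintro _ rfl v hv
    rw [funext hv]
    rfl
  exact this _ (by simp) _ (fun i => by simp [Fin.cast])

theorem contDiff_iteratedFDeriv_apply (hf : ContDiff ℝ ∞ f) {k : ℕ} {g : Fin k → E → E}
    (hg : ∀ i, ContDiff ℝ ∞ (g i)) :
    ContDiff ℝ ∞ fun y => iteratedFDeriv ℝ k f y fun i => g i y := by
  have h1 : ContDiff ℝ ∞ fun z => iteratedFDeriv ℝ k f z :=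
    hf.iteratedFDeriv_right (by exact_mod_cast le_top)
  -- Joint evaluation `(A, v) ↦ A v` is continuous multilinear with slots in `Option (Fin k)`, the
  -- slot `none` holding `A`; hence it is smooth.
  have h2 := (ContinuousLinearMap.id ℝ (ContinuousMultilinearMap ℝ (fun _ : Fin k => E) E)
    |>.continuousMultilinearMapOption).contDiff (n := ∞)
  have h3 := h2.comp (contDiff_pi.2 fun _ : Option (Fin k) => h1.prodMk (contDiff_pi.2 hg))
  exact h3

theorem contDiff_elementaryDifferential (hf : ContDiff ℝ ∞ f) (τ : RTree) :
    ContDiff ℝ ∞ (elementaryDifferential f τ) := by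
  induction τ using RTree.induction with
  | h s ih =>
    obtain ⟨k, w, hw⟩ := exists_node_ofFn (node s)
    have hs := node_injective hw
    rw [hw, funext (elementaryDifferential_node_ofFn hf w)]
    refine contDiff_iteratedFDeriv_apply hf fun i => ih _ ?_
    rw [hs]
    simp

open Classical in
theorem ofFn_update {α : Type*} {k : ℕ} (w : Fin k → α) (i : Fin k) (g : α) :
    ((List.ofFn (Function.update w i g) : List α) : Multiset α) =
      g ::ₘ (List.ofFn w : Multiset α).erase (w i) := by
  have h : ∀ w : Fin k → α, ((List.ofFn w : List α) : Multiset α) =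
      w i ::ₘ (Finset.univ.erase i).val.map w := by
    intro w
    rw [← Multiset.map_cons, Finset.erase_val,
      Multiset.cons_erase (Finset.mem_univ_val i), Fin.univ_val_map]
  rw [h, h w, Multiset.erase_cons_head, Function.update_self]
  congr 1
  refine Multiset.map_congr rfl fun j hj => ?_
  rw [Function.update_of_ne]
  exact Finset.ne_of_mem_erase (s := Finset.univ) hj

/-- The product rule: differentiating `f⁽ᵏ⁾` attaches `τ₁` to the root, and differentiating the
`i`-th argument grafts it into the `i`-th branch. -/
theorem fderiv_elementaryDifferential (hf : ContDiff ℝ ∞ f) (τ₁ τ₂ : RTree) (y : E) :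
    fderiv ℝ (elementaryDifferential f τ₂) y (elementaryDifferential f τ₁ y) =
      ((graft τ₁ τ₂).map fun g => elementaryDifferential f g y).sum := by
  classical
  induction τ₂ using RTree.induction with
  | h s ih =>
    obtain ⟨k, w, hw⟩ := exists_node_ofFn (node s)
    obtain rfl := node_injective hw
    have h1 : DifferentiableAt ℝ (fun z => iteratedFDeriv ℝ k f z) y :=
      (hf.iteratedFDeriv_right (m := ∞) (by exact_mod_cast le_top)).differentiable (by simp) y
    have h2 : ∀ i, HasFDerivAt (elementaryDifferential f (w i))
        (fderiv ℝ (elementaryDifferential f (w i)) y) y := fun i =>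
      ((contDiff_elementaryDifferential hf (w i)).differentiable (by simp) y).hasFDerivAt
    rw [funext (elementaryDifferential_node_ofFn hf w),
      (h1.hasFDerivAt.continuousMultilinearMap_apply h2).fderiv, graft_node, Multiset.map_cons,
      Multiset.sum_cons, add_apply]
    congr 1
    · have h3 : τ₁ ::ₘ ((List.ofFn w : List RTree) : Multiset RTree) =
          (List.ofFn (Fin.cons τ₁ w : Fin (k + 1) → RTree) : List RTree) := by
        rw [List.ofFn_succ]; rfl
      rw [h3, elementaryDifferential_node_ofFn hf, iteratedFDeriv_succ_apply_left]
      rfl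
    · have h4 : ∀ {M : Type} [AddCommMonoid M] (φ : RTree → M),
          (((List.ofFn w : List RTree) : Multiset RTree).map φ).sum = ∑ i, φ (w i) := by
        intro M _ φ
        rw [Multiset.map_coe, List.map_ofFn, Multiset.sum_coe, List.sum_ofFn]
        rfl
      rw [Multiset.map_bind, Multiset.sum_bind, h4, sum_apply]
      refine Finset.sum_congr rfl fun i _ => ?_
      rw [ContinuousLinearMap.comp_apply, ih (w i) (by simp), map_multiset_sum, Multiset.map_map,
        Multiset.map_map]
      congr 1
      refine Multiset.map_congr rfl fun g _ => ?_
      rw [Function.comp_apply, Function.comp_apply, ← ofFn_update,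
        elementaryDifferential_node_ofFn hf]
      change iteratedFDeriv ℝ k f y (Function.update _ i _) = _
      congr 1
      ext j
      rcases eq_or_ne j i with rfl | hj
      · simp
      · simp [hj]

end RTree

namespace FormalField

open MvPolynomial hiding counit counit_X
open BCK ButcherCharacter RTree

variable {E : Type} [NormedAddCommGroup E] [NormedSpace ℝ E]

/-! ### Existence and uniqueness of the modified equation -/

theorem lieDeriv_idSeries (c : ℕ → E → E) : lieDeriv c idSeries = c := by
  funext n y
  rw [lieDeriv, Finset.sum_eq_single (n, 0)]
  · have h : (idSeries 0 : E → E) = id := by funext y; simp [idSeries]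
    rw [h]
    simp
  · intro p hp hne
    have h1 : p.2 ≠ 0 := by
      intro h
      have := Finset.HasAntidiagonal.mem_antidiagonal.1 hp
      exact hne (Prod.ext (by simpa [h] using this) h)
    have h2 : (idSeries p.2 : E → E) = fun _ => 0 := by funext y; simp [idSeries, h1]
    rw [h2]
    simp
  · simp [Finset.HasAntidiagonal.mem_antidiagonal]

theorem lieDeriv_iterate_congr {c c' : ℕ → E → E} (i : ℕ) {n : ℕ} (h : ∀ k ≤ n, c k = c' k) :
    ∀ k ≤ n, (lieDeriv c)^[i] idSeries k = (lieDeriv c')^[i] idSeries k := by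
  induction i with
  | zero => exact fun _ _ => rfl
  | succ i ih =>
    intro k hk
    rw [Function.iterate_succ_apply', Function.iterate_succ_apply']
    funext y
    refine Finset.sum_congr rfl fun p hp => ?_
    have := Finset.HasAntidiagonal.mem_antidiagonal.1 hp
    rw [h p.1 (by omega), ih p.2 (by omega)]

/-- In the term of index `i` only coefficients of index at most `n + 1 - i` occur, so `c n` enters
through `i = 1` alone; the term `i = 0` does not contain the field. -/
theorem flowCoeff_sub_flowCoeff {c c' : ℕ → E → E} {n : ℕ} (h : ∀ k < n, c k = c' k) (y : E) :
    flowCoeff c (n + 1) y - flowCoeff c' (n + 1) y = c n y - c' n y := by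
  rw [flowCoeff, flowCoeff, ← Finset.sum_sub_distrib, Finset.sum_eq_single 1]
  · simp [lieDeriv_idSeries]
  · intro i hi hne
    rw [Finset.mem_range] at hi
    rcases i with _ | i
    · simp
    · rw [lieDeriv_iterate_congr (c := c) (c' := c') (i + 1) (n := n - 1)
        (fun k hk => h k (by omega)) _ (by omega), sub_self]
  · simp

theorem flowCoeff_zero (c : ℕ → E → E) (y : E) : flowCoeff c 0 y = y := by
  simp [flowCoeff, idSeries]

theorem eq_of_flowCoeff_eq {c c' : ℕ → E → E} {n : ℕ}
    (h : ∀ k ≤ n, ∀ y, flowCoeff c k y = flowCoeff c' k y) : ∀ k < n, c k = c' k := by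
  intro k
  induction k using Nat.strong_induction_on with
  | _ k ih =>
    intro hk
    funext y
    have := flowCoeff_sub_flowCoeff (fun j hj => ih j hj (by omega)) y
    rw [h (k + 1) hk y, sub_self] at this
    exact sub_eq_zero.1 this.symm

theorem contDiff_lieDeriv {c G : ℕ → E → E} (hc : ∀ k, ContDiff ℝ ∞ (c k))
    (hG : ∀ k, ContDiff ℝ ∞ (G k)) (n : ℕ) : ContDiff ℝ ∞ (lieDeriv c G n) :=
  ContDiff.sum fun p _ => ((hG p.2).fderiv_right (m := ∞) (by simp)).clm_apply (hc p.1)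

theorem contDiff_flowCoeff {c : ℕ → E → E} (hc : ∀ k, ContDiff ℝ ∞ (c k)) (n : ℕ) :
    ContDiff ℝ ∞ (flowCoeff c n) := by
  refine ContDiff.sum fun i hi => contDiff_const.smul ?_
  clear hi
  have h : ∀ k, ContDiff ℝ ∞ ((lieDeriv c)^[i] idSeries k) := by
    induction i with
    | zero =>
      intro k
      rcases k with _ | k
      · exact contDiff_id
      · exact contDiff_const
    | succ i ih =>
      rw [Function.iterate_succ_apply']
      exact contDiff_lieDeriv hc ih
  exact h _

/-- The recursive construction of a formal vector field with given formal time `h` flow; the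
coefficients of index less than `n` are correct, and the others vanish. -/
def ofFlowAux (b : ℕ → E → E) : ℕ → ℕ → E → E
  | 0 => 0
  | n + 1 => Function.update (ofFlowAux b n) n fun y =>
      b (n + 1) y - flowCoeff (ofFlowAux b n) (n + 1) y

/-- The formal vector field with given formal time `h` flow. -/
def ofFlow (b : ℕ → E → E) (k : ℕ) : E → E := ofFlowAux b (k + 1) k

theorem ofFlowAux_of_le (b : ℕ → E → E) {n k : ℕ} (h : n ≤ k) : ofFlowAux b n k = 0 := by
  induction n with
  | zero => rfl
  | succ n ih => rw [ofFlowAux, Function.update_of_ne (by omega), ih (by omega)]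

theorem ofFlowAux_of_lt (b : ℕ → E → E) {n k : ℕ} (h : k < n) :
    ofFlowAux b n k = ofFlow b k := by
  induction n with
  | zero => omega
  | succ n ih =>
    rcases Nat.eq_or_lt_of_le (Nat.lt_succ_iff.1 h) with rfl | h
    · rfl
    · rw [ofFlowAux, Function.update_of_ne h.ne, ih h]

theorem flowCoeff_ofFlow (b : ℕ → E → E) (n : ℕ) (y : E) :
    flowCoeff (ofFlow b) (n + 1) y = b (n + 1) y := by
  have h1 := flowCoeff_sub_flowCoeff (c := ofFlow b) (c' := ofFlowAux b n)
    (fun k hk => (ofFlowAux_of_lt b hk).symm) y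
  rw [ofFlowAux_of_le b le_rfl, ofFlow, ofFlowAux, Function.update_self] at h1
  simpa using h1

theorem contDiff_ofFlow {b : ℕ → E → E} (hb : ∀ k, ContDiff ℝ ∞ (b k)) (k : ℕ) :
    ContDiff ℝ ∞ (ofFlow b k) := by
  have h : ∀ n k, ContDiff ℝ ∞ (ofFlowAux b n k) := by
    intro n
    induction n with
    | zero => exact fun k => contDiff_const
    | succ n ih =>
      intro k
      rcases eq_or_ne k n with rfl | hk
      · rw [ofFlowAux, Function.update_self]
        exact (hb _).sub (contDiff_flowCoeff ih _)
      · rw [ofFlowAux, Function.update_of_ne hk]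
        exact ih k
  exact h _ _

theorem existsUnique_isModifiedEquation {f : E → E} (hf : ContDiff ℝ ∞ f) (ψ : ButcherCharacter) :
    ∃! c : ℕ → E → E, IsModifiedEquation ψ f c := by
  refine ⟨ofFlow (ψ.bSeriesCoeff f), ⟨contDiff_ofFlow fun k => ?_, fun n y => ?_⟩, ?_⟩
  · rcases k with _ | k
    · exact contDiff_id
    · change ContDiff ℝ ∞ fun y => bSeriesCoeff ψ f (k + 1) y
      simp only [bSeriesCoeff, Nat.succ_ne_zero, if_false]
      exact ContDiff.sum fun τ _ => (contDiff_elementaryDifferential hf τ).const_smul _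
  · rcases n with _ | n
    · rw [flowCoeff_zero, bSeriesCoeff, if_pos rfl]
    · rw [flowCoeff_ofFlow]
  · intro c hc
    funext k
    refine eq_of_flowCoeff_eq (n := k + 1) (fun j _ y => ?_) k (Nat.lt_succ_self k)
    rw [hc.flow_eq]
    rcases j with _ | n
    · rw [flowCoeff_zero, bSeriesCoeff, if_pos rfl]
    · rw [flowCoeff_ofFlow]

/-! ### The flow of a B-series vector field -/

/-- The elementary differentials of order `n`, weighted with given coefficients. -/
def elementarySum (f : E → E) (b : RTree → ℝ) (n : ℕ) (y : E) : E :=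
  ∑ τ ∈ ofOrder n, (b τ / τ.symmetryFactor) • elementaryDifferential f τ y

theorem _root_.Multiset.sum_map_eq_sum_count {α M : Type*} [DecidableEq α] [AddCommMonoid M]
    (s : Multiset α) (g : α → M) (S : Finset α) (h : ∀ q ∈ s, q ∉ S → g q = 0) :
    (s.map g).sum = ∑ q ∈ S, s.count q • g q := by
  rw [Finset.sum_multiset_map_count, Finset.sum_subset Finset.subset_union_left,
    ← Finset.sum_subset (Finset.subset_union_right (s₁ := s.toFinset))]
  · intro q hq hS
    rw [Finset.mem_union, or_iff_left hS, Multiset.mem_toFinset] at hq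
    rw [h q hq hS, smul_zero]
  · intro q _ hs
    rw [Multiset.mem_toFinset] at hs
    rw [Multiset.count_eq_zero_of_notMem hs, zero_smul]

theorem fderiv_elementarySum {f : E → E} (hf : ContDiff ℝ ∞ f) (b : RTree → ℝ) (n : ℕ) (y v : E) :
    fderiv ℝ (elementarySum f b n) y v = ∑ τ ∈ ofOrder n,
      (b τ / τ.symmetryFactor) • fderiv ℝ (elementaryDifferential f τ) y v := by
  have h : ∀ τ, DifferentiableAt ℝ (elementaryDifferential f τ) y := fun τ =>
    (contDiff_elementaryDifferential hf τ).differentiable (by simp) y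
  have h1 : HasFDerivAt (elementarySum f b n) (∑ τ ∈ ofOrder n,
      (b τ / τ.symmetryFactor) • fderiv ℝ (elementaryDifferential f τ) y) y :=
    HasFDerivAt.fun_sum fun τ _ => (h τ).hasFDerivAt.const_smul _
  rw [h1.fderiv, sum_apply]
  rfl

/-- One Lie derivative in terms of trees. The left side contains only cuts whose remaining tree has
order at least `i`; the hypothesis on `b` makes the other cuts vanish on the right. -/
theorem sum_fderiv_elementarySum {f : E → E} (hf : ContDiff ℝ ∞ f) {a b : RTree → ℝ} {i : ℕ}
    (hb : ∀ τ : RTree, τ.order < i → b τ = 0) (j : ℕ) (y : E) :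
    ∑ p ∈ Finset.HasAntidiagonal.antidiagonal j,
      fderiv ℝ (elementarySum f b (i + p.2)) y (elementarySum f a (p.1 + 1) y) =
    elementarySum f (fun τ => (τ.edgeCuts.map fun q => a q.1 * b q.2).sum) (i + 1 + j) y := by
  classical
  -- The pairs `(P, R)` that occur on the left, for all splittings of `j` at once.
  set S : Finset (RTree × RTree) := (Finset.HasAntidiagonal.antidiagonal j).biUnion fun p =>
    ofOrder (p.1 + 1) ×ˢ ofOrder (i + p.2)
  have hS : ∀ q : RTree × RTree, q ∈ S ↔ q.1.order + q.2.order = i + 1 + j ∧ i ≤ q.2.order := by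
    intro q
    have := q.1.order_pos
    simp only [S, Finset.mem_biUnion, Finset.mem_product, mem_ofOrder,
      Finset.HasAntidiagonal.mem_antidiagonal]
    constructor
    · rintro ⟨p, h1, h2, h3⟩
      omega
    · rintro ⟨h1, h2⟩
      exact ⟨(q.1.order - 1, q.2.order - i), by omega, by omega, by omega⟩
  have h1 : ∀ q ∈ S, fderiv ℝ (elementaryDifferential f q.2) y (elementaryDifferential f q.1 y) =
      ∑ τ ∈ ofOrder (i + 1 + j), (graft q.1 q.2).count τ • elementaryDifferential f τ y := by
    intro q hq
    rw [fderiv_elementaryDifferential hf]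
    refine Multiset.sum_map_eq_sum_count _ _ _ fun g hg hne => ?_
    rw [mem_ofOrder, order_of_mem_graft _ _ g hg] at hne
    exact (hne ((hS q).1 hq).1).elim
  calc _ = ∑ q ∈ S, ((a q.1 / q.1.symmetryFactor) * (b q.2 / q.2.symmetryFactor)) •
        fderiv ℝ (elementaryDifferential f q.2) y (elementaryDifferential f q.1 y) := by
        rw [Finset.sum_biUnion]
        · refine Finset.sum_congr rfl fun p _ => ?_
          rw [fderiv_elementarySum hf, Finset.sum_product_right]
          refine Finset.sum_congr rfl fun τ₂ _ => ?_
          rw [elementarySum, map_sum, Finset.smul_sum]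
          refine Finset.sum_congr rfl fun τ₁ _ => ?_
          rw [map_smul, smul_smul, mul_comm]
        · intro p hp p' hp' hne
          refine Finset.disjoint_left.2 fun q hq hq' => hne ?_
          simp only [Finset.mem_product, mem_ofOrder] at hq hq'
          exact Prod.ext (by omega) (by omega)
    _ = ∑ q ∈ S, ∑ τ ∈ ofOrder (i + 1 + j), ((τ.edgeCuts.count q * (a q.1 * b q.2)) /
          τ.symmetryFactor) • elementaryDifferential f τ y := by
        refine Finset.sum_congr rfl fun q hq => ?_
        rw [h1 q hq, Finset.smul_sum]
        refine Finset.sum_congr rfl fun τ _ => ?_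
        rw [← Nat.cast_smul_eq_nsmul ℝ, smul_smul]
        congr 1
        have h2 := symmetryFactor_mul_count_graft q.1 q.2 τ
        have h3 : (τ.symmetryFactor * (graft q.1 q.2).count τ : ℝ) =
            q.1.symmetryFactor * q.2.symmetryFactor * τ.edgeCuts.count q := by
          exact_mod_cast h2
        have h4 : (τ.symmetryFactor : ℝ) ≠ 0 := by exact_mod_cast τ.symmetryFactor_pos.ne'
        have h5 : (q.1.symmetryFactor : ℝ) ≠ 0 := by exact_mod_cast q.1.symmetryFactor_pos.ne'
        have h6 : (q.2.symmetryFactor : ℝ) ≠ 0 := by exact_mod_cast q.2.symmetryFactor_pos.ne'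
        field_simp
        linear_combination (a q.1 * b q.2) * h3
    _ = _ := by
        rw [Finset.sum_comm, elementarySum]
        refine Finset.sum_congr rfl fun τ hτ => ?_
        rw [mem_ofOrder] at hτ
        rw [← Finset.sum_smul, ← Finset.sum_div, Multiset.sum_map_eq_sum_count _ _ S]
        · simp only [nsmul_eq_mul]
        · intro q hq hne
          rw [hS, τ.order_of_mem_edgeCuts q hq] at hne
          rw [hb q.2 (by omega), mul_zero]

/-- Coefficient `j` sits at order `i + 1 + j`, since each application of the field adds one vertex
more than its power of `h`. -/
theorem lieDeriv_iterate_elementarySum {f : E → E} (hf : ContDiff ℝ ∞ f) (a : RTree → ℝ) (i : ℕ) :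
    (lieDeriv fun k => elementarySum f a (k + 1))^[i + 1] idSeries =
      fun j => elementarySum f (fun τ => infinitesimalPow a (i + 1) (X τ)) (i + 1 + j) := by
  induction i with
  | zero =>
    rw [zero_add, Function.iterate_one, lieDeriv_idSeries]
    simp only [infinitesimalPow_one_X, add_comm]
  | succ i ih =>
    rw [Function.iterate_succ_apply', ih]
    funext j y
    rw [lieDeriv, sum_fderiv_elementarySum hf fun τ hτ => infinitesimalPow_X_eq_zero a hτ]
    simp only [infinitesimalPow_succ_X a (Nat.succ_ne_zero i)]

/-- The B-series vector field of an infinitesimal character flows to the B-series of its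
exponential. -/
theorem flowCoeff_elementarySum {f : E → E} (hf : ContDiff ℝ ∞ f) (a : RTree → ℝ) (n : ℕ) (y : E) :
    flowCoeff (fun k => elementarySum f a (k + 1)) n y =
      (ButcherCharacter.exp a).bSeriesCoeff f n y := by
  rcases n with _ | n
  · rw [flowCoeff_zero, bSeriesCoeff, if_pos rfl]
  -- The term `i = 0` is the identity series, which vanishes in positive degree, just as the counit
  -- vanishes on trees.
  · rw [flowCoeff, bSeriesCoeff, if_neg (Nat.succ_ne_zero n), Finset.sum_range_succ',
      Function.iterate_zero, id, idSeries, if_neg (by simp), smul_zero, add_zero]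
    have h : ∀ i ∈ Finset.range (n + 1), (1 / ((i + 1).factorial : ℝ)) •
        (lieDeriv fun k => elementarySum f a (k + 1))^[i + 1] idSeries (n + 1 - (i + 1)) y =
        ∑ τ ∈ ofOrder (n + 1), ((infinitesimalPow a (i + 1) (X τ) / (i + 1).factorial) /
          τ.symmetryFactor) • elementaryDifferential f τ y := by
      intro i hi
      rw [Finset.mem_range] at hi
      rw [lieDeriv_iterate_elementarySum hf]
      beta_reduce
      rw [Nat.add_sub_cancel' (Nat.succ_le_succ (Nat.le_of_lt_succ hi)), elementarySum,
        Finset.smul_sum]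
      refine Finset.sum_congr rfl fun τ _ => ?_
      rw [smul_smul]
      congr 1
      ring
    rw [Finset.sum_congr rfl h, Finset.sum_comm]
    refine Finset.sum_congr rfl fun τ hτ => ?_
    rw [mem_ofOrder] at hτ
    rw [← Finset.sum_smul, exp_X, hτ, Finset.sum_range_succ' _ (n + 1), infinitesimalPow_zero,
      counit_X, zero_div, add_zero, Finset.sum_div]

end FormalField

/-! ### Coefficients of the modified equation -/

namespace IsModifiedEquation

open FormalField ButcherCharacter RTree

variable {E : Type} [NormedAddCommGroup E] [NormedSpace ℝ E] {f : E → E} {ψ : ButcherCharacter}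
  {c : ℕ → E → E}

theorem coeff_zero (hf : ContDiff ℝ ∞ f) (h : IsModifiedEquation ψ f c) :
    c 0 = ψ (MvPolynomial.X single) • f := by
  have h1 : ∀ τ : RTree, τ.order = 1 ↔ τ = single := by
    intro τ
    constructor
    · intro hτ
      rw [← node_branches τ, order_node] at hτ
      rw [← node_branches τ, single]
      congr 1
      by_contra hne
      obtain ⟨t, ht⟩ := Multiset.exists_mem_of_ne_zero hne
      have := Multiset.single_le_sum (fun x _ => Nat.zero_le x) _
        (Multiset.mem_map_of_mem order ht)
      have := t.order_pos
      omega
    · rintro rfl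
      simp [single, order_node]
  have h2 : ofOrder 1 = {single} := by
    ext τ
    rw [mem_ofOrder, h1, Finset.mem_singleton]
  have h3 : ∀ y, elementaryDifferential f single y = f y := fun y =>
    (elementaryDifferential_node hf [] y).trans (iteratedFDeriv_zero_apply _)
  funext y
  have h4 := h.flow_eq 1 y
  -- Comparison with the zero field isolates `c 0` as the coefficient of `h`, to which only the
  -- one-vertex tree contributes.
  have h5 := flowCoeff_sub_flowCoeff (c := c) (c' := 0) (n := 0) (fun k hk => by omega) y
  have h6 : flowCoeff (0 : ℕ → E → E) 1 y = 0 := by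
    simp [flowCoeff, Finset.sum_range_succ, lieDeriv_idSeries, idSeries]
  rw [h6, h4, bSeriesCoeff, if_neg one_ne_zero, h2, Finset.sum_singleton, h3] at h5
  simpa [single, symmetryFactor_node] using h5.symm

theorem coeff_eq_zero (hf : ContDiff ℝ ∞ f) (h : IsModifiedEquation ψ f c) {j : ℕ} (hj : 1 ≤ j)
    (he : Even j) (hle : (j : ℕ∞) ≤ ψ.antisymmetricOrder) : c (j - 1) = 0 := by
  obtain ⟨a, ha⟩ := exists_exp_X_eq ψ j
  -- The flows agree through order `j`, so the fields agree through index `j - 1`, which corresponds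
  -- to trees of order `j`.
  have h1 : ∀ k < j, c k = elementarySum f a (k + 1) := by
    refine eq_of_flowCoeff_eq (c' := fun k => elementarySum f a (k + 1)) fun k hk y => ?_
    rw [h.flow_eq, flowCoeff_elementarySum hf, bSeriesCoeff, bSeriesCoeff]
    split_ifs
    · rfl
    · refine Finset.sum_congr rfl fun τ hτ => ?_
      rw [mem_ofOrder] at hτ
      rw [ha τ (by omega)]
  rw [h1 _ (by omega), Nat.sub_add_cancel hj]
  funext y
  refine Finset.sum_eq_zero fun τ hτ => ?_
  rw [mem_ofOrder] at hτ
  rw [eq_zero_of_even_order ha (fun t ht => mul_bar_X_eq_zero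
    (fun u hu => plus_eq_zero_of_le_antisymmetricOrder hle u hu) ht) τ hτ.le (hτ ▸ he),
    zero_div, zero_smul]

end IsModifiedEquation

/-! ### The expansion in even powers -/

theorem sum_range_eq_sum_even {E : Type*} [AddCommGroup E] (u : ℕ → E) (M : ℕ)
    (h : ∀ k < M, Odd k → u k = 0) :
    ∑ k ∈ Finset.range M, u k = ∑ l ∈ Finset.range ((M + 1) / 2), u (2 * l) := by
  induction M with
  | zero => rfl
  | succ M ih =>
    rw [Finset.sum_range_succ, ih fun k hk => h k (by omega)]
    rcases Nat.even_or_odd' M with ⟨l, rfl | rfl⟩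
    · rw [show (2 * l + 1 + 1) / 2 = l + 1 by omega, show (2 * l + 1) / 2 = l by omega,
        Finset.sum_range_succ]
    · rw [h (2 * l + 1) (by omega) ⟨l, rfl⟩, add_zero]
      congr 2
      omega

end
theorem mainTheorem11 (N : ℕ) (f : EuclideanSpace ℝ (Fin N) → EuclideanSpace ℝ (Fin N))
    (hf : ContDiff ℝ ∞ f) (ψ : ButcherCharacter) (m : ℕ∞) (hm : ψ.antisymmetricOrder = m) :
    (∃! c : ℕ → EuclideanSpace ℝ (Fin N) → EuclideanSpace ℝ (Fin N), IsModifiedEquation ψ f c) ∧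
    ∀ c : ℕ → EuclideanSpace ℝ (Fin N) → EuclideanSpace ℝ (Fin N), IsModifiedEquation ψ f c →
      c 0 = ψ (MvPolynomial.X RTree.single) • f ∧
      (∀ j : ℕ, 1 ≤ j → Even j → (j : ℕ∞) ≤ m → c (j - 1) = 0) ∧
      (∀ M : ℕ, (M : ℕ∞) ≤ m → ∀ (h : ℝ) (y : EuclideanSpace ℝ (Fin N)),
        ∑ k ∈ Finset.range M, h ^ k • c k y =
          ∑ l ∈ Finset.range ((M + 1) / 2), h ^ (2 * l) • c (2 * l) y) := by
  subst hm
  refine ⟨FormalField.existsUnique_isModifiedEquation hf ψ, fun c hc =>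
    ⟨hc.coeff_zero hf, fun j hj he hle => hc.coeff_eq_zero hf hj he hle, fun M hM h y => ?_⟩⟩
  refine sum_range_eq_sum_even (fun k => h ^ k • c k y) M fun k hk hodd => ?_
  -- An odd power `h ^ k` with `k < M` carries `f_{k+1}`, and `k + 1` is even and at most `M ≤ m`.
  have h1 := hc.coeff_eq_zero hf (j := k + 1) (by omega) hodd.add_one
    (le_trans (by exact_mod_cast hk) hM)
  rw [Nat.add_sub_cancel] at h1
  simp [h1]
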